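/- Let $k\in\mathbb N$, let $\rho\in(0,1)^k$ with $\sum_{i}\rho_i=1$, let $P\in(0,1)^{k\times k}$ be symmetric, and let $t>0$. In the censored stochastic block model $\mathrm{CSBM}_n^k(\rho,P,t)$ each vertex $v\in[n]$ receives a label $\sigma_0(v)\in[k]$ independently with $\mathbb P(\sigma_0(v)=i)=\rho_i$. Given $\sigma_0$, independently over all pairs $u\neq v$, the edge $\{u,v\}$ exists with probability $P_{\sigma_0(u)\sigma_0(v)}$, and, independently of this, the status of the pair is revealed with probability $\frac{t\log n}{n}$ (truncated at $1$ for the finitely many $n$ for which this exceeds $1$). The observation $G$ records for every pair whether it is present (exists and is revealed), absent (does not exist and is revealed) or censored (is not revealed). The MAP estimator $\hat\sigma_{\mathrm{MAP}}$ is drawn uniformly at random from $\arg\max_{\sigma:[n]\to[k]}\mathbb P(\sigma_0=\sigma\mid G)$. An estimator $\hat\sigma$ achieves exact recovery if there is a $k\times k$ permutation matrix $J$ with $\hat SJ=S_0$, where $\hat S_{ui}=\mathbf 1\{\hat\sigma(u)=i\}$ and $(S_0)_{ui}=\mathbf 1\{\sigma_0(u)=i\}$. For $\mu,\nu\in(0,\infty)^{l}$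 let $$\Delta_+(\mu,\nu)=\max_{\xi\in[0,1]}\sum_{i=1}^{l}\big[\xi\mu_i+(1-\xi)\nu_i-\mu_i^{\xi}\nu_i^{1-\xi}\big],$$ and let $$t_c=\Big(\min_{i\neq j}\Delta_+(\theta_i,\theta_j)\Big)^{-1}\in(0,\infty],\qquad \theta_i=\big(\rho_rP_{ri},\,\rho_r(1-P_{ri})\big)_{r\in[k]}\in\mathbb R^{2k},$$ with $t_c=\infty$ if the minimum is $0$. **Theorem.** If $t>t_c$, then $$\lim_{n\to\infty}\mathbb P\big(\hat\sigma_{\mathrm{MAP}}\text{ achieves exact recovery}\big)=1 .$$ Moreover, the same holds conditionally on the labels: if $\sigma_0^{(n)}:[n]\to[k]$ are fixed assignments such that, for all sufficiently large $n$, $\big||\{v:\sigma_0^{(n)}(v)=j\}|-n\rho_j\big|\le n^{-1/3}\,n$ for every $j\in[k]$, then $$\lim_{n\to\infty}\mathbb P\big(\hat\sigma_{\mathrm{MAP}}\text{ achieves exact recovery}\,\big|\,\sigma_0=\sigma_0^{(n)}\big)=1 .$$ -/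

import Mathlib

namespace CSBM

/-- What is observed about a pair of vertices in a censored graph. -/
inductive EdgeStatus
  | present
  | absent
  | censored
  deriving DecidableEq

instance : Fintype EdgeStatus where
  elems := {EdgeStatus.present, EdgeStatus.absent, EdgeStatus.censored}
  complete := by intro s; cases s <;> simp

/-- Unordered pairs of distinct vertices of `[n]`, each listed once, as `(u, v)` with `u < v`. -/
abbrev VertexPair (n : ℕ) : Type := {e : Fin n × Fin n // e.1 < e.2}

/-- A censored graph on `[n]`: a status for every pair of distinct vertices. -/
abbrev CensoredGraph (n : ℕ) : Type := VertexPair n → EdgeStatus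

/-- A community assignment of `[n]` into `k` communities. -/
abbrev Assignment (n k : ℕ) : Type := Fin n → Fin k

/-- The observed status of a pair, from the existence of the edge and whether it is revealed. -/
def observe (edge revealed : Bool) : EdgeStatus :=
  if revealed then (if edge then EdgeStatus.present else EdgeStatus.absent)
  else EdgeStatus.censored

/-- The Bernoulli distribution with success probability `p`. -/
def bernoulliProb (p : ℝ) (b : Bool) : ℝ := if b then p else 1 - p

/-- The law of the observed status of a pair whose edge exists with probability `p` and whose
connectivity status is, independently, revealed with probability `α`. -/
def statusProb (p α : ℝ) (s : EdgeStatus) : ℝ :=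
  ∑ edge : Bool, ∑ revealed : Bool,
    if observe edge revealed = s then bernoulliProb p edge * bernoulliProb α revealed else 0

/-- The probability `t log n / n` with which a status is revealed. For fixed `t` it is at most `1`
for all but finitely many `n`; it is truncated at `1` for the others, so that the model is defined
for every `n`. -/
noncomputable def revealProb (t : ℝ) (n : ℕ) : ℝ := min 1 (t * Real.log n / n)

/-- `ℙ(σ₀ = σ)`: the labels are independent with distribution `ρ`. -/
def labelProb {k : ℕ} (ρ : Fin k → ℝ) {n : ℕ} (σ : Assignment n k) : ℝ := ∏ v, ρ (σ v)

/-- `ℙ(G | σ₀ = σ)`: given the labels, the statuses of the pairs are independent. -/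
noncomputable def graphProb {k : ℕ} (P : Matrix (Fin k) (Fin k) ℝ) (t : ℝ) {n : ℕ}
    (σ : Assignment n k) (G : CensoredGraph n) : ℝ :=
  ∏ e : VertexPair n, statusProb (P (σ e.1.1) (σ e.1.2)) (revealProb t n) (G e)

/-- The posterior probability `ℙ(σ₀ = σ | G)`. -/
noncomputable def posterior {k : ℕ} (ρ : Fin k → ℝ) (P : Matrix (Fin k) (Fin k) ℝ) (t : ℝ) {n : ℕ}
    (G : CensoredGraph n) (σ : Assignment n k) : ℝ :=
  labelProb ρ σ * graphProb P t σ G / ∑ τ : Assignment n k, labelProb ρ τ * graphProb P t τ G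

open Classical in
/-- The set of assignments that maximize the posterior probability. -/
noncomputable def mapArgmax {k : ℕ} (ρ : Fin k → ℝ) (P : Matrix (Fin k) (Fin k) ℝ) (t : ℝ) {n : ℕ}
    (G : CensoredGraph n) : Finset (Assignment n k) :=
  Finset.univ.filter fun σ => ∀ τ, posterior ρ P t G τ ≤ posterior ρ P t G σ

open Classical in
/-- The MAP estimator: given `G`, its output is uniformly distributed on the set of maximizers of
the posterior. This is the probability that the output is `σ`. -/
noncomputable def mapEstimator {k : ℕ} (ρ : Fin k → ℝ) (P : Matrix (Fin k) (Fin k) ℝ) (t : ℝ)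
    {n : ℕ} (G : CensoredGraph n) (σ : Assignment n k) : ℝ :=
  if σ ∈ mapArgmax ρ P t G then ((mapArgmax ρ P t G).card : ℝ)⁻¹ else 0

/-- The `n × k` membership matrix of an assignment. -/
def membership {n k : ℕ} (σ : Assignment n k) : Matrix (Fin n) (Fin k) ℝ :=
  Matrix.of fun u i => if σ u = i then 1 else 0

/-- The estimate `σ'` agrees with `σ₀` up to a permutation of the communities. -/
def ExactRecovery {n k : ℕ} (σ' σ₀ : Assignment n k) : Prop :=
  ∃ π : Equiv.Perm (Fin k), membership σ' * π.permMatrix ℝ = membership σ₀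

open Classical in
/-- The conditional probability, given the true labels `σ₀`, that the MAP estimator achieves exact
recovery (over the random graph and the random choice of a maximizer). -/
noncomputable def mapSuccessGiven {k : ℕ} (ρ : Fin k → ℝ) (P : Matrix (Fin k) (Fin k) ℝ) (t : ℝ)
    {n : ℕ} (σ₀ : Assignment n k) : ℝ :=
  ∑ G : CensoredGraph n, graphProb P t σ₀ G *
    ∑ σ' : Assignment n k, if ExactRecovery σ' σ₀ then mapEstimator ρ P t G σ' else 0

/-- The probability that the MAP estimator achieves exact recovery on `n` vertices (over the
random labels, the random graph and the random choice of a maximizer). -/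
noncomputable def mapSuccess {k : ℕ} (ρ : Fin k → ℝ) (P : Matrix (Fin k) (Fin k) ℝ) (t : ℝ)
    (n : ℕ) : ℝ :=
  ∑ σ₀ : Assignment n k, labelProb ρ σ₀ * mapSuccessGiven ρ P t σ₀

/-- `CH_ξ(μ, ν)`. -/
noncomputable def chAt {ι : Type*} [Fintype ι] (ξ : ℝ) (μ ν : ι → ℝ) : ℝ :=
  ∑ i, (ξ * μ i + (1 - ξ) * ν i - μ i ^ ξ * ν i ^ (1 - ξ))

/-- The Chernoff–Hellinger divergence `Δ₊(μ, ν)` of two vectors with positive entries. The set of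
values is nonempty and bounded (and the supremum is attained, by continuity). -/
noncomputable def chDivergence {ι : Type*} [Fintype ι] (μ ν : ι → ℝ) : ℝ :=
  sSup ((fun ξ => chAt ξ μ ν) '' Set.Icc (0 : ℝ) 1)

/-- The vector `θ_i = (ρ_r P_{ri}, ρ_r (1 - P_{ri}))_{r ∈ [k]}` in `ℝ^{2k}`. -/
def theta {k : ℕ} (ρ : Fin k → ℝ) (P : Matrix (Fin k) (Fin k) ℝ) (i : Fin k) :
    Fin k ⊕ Fin k → ℝ :=
  Sum.elim (fun r => ρ r * P r i) (fun r => ρ r * (1 - P r i))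

/-- The threshold `t_c`, with `t_c = ∞` when the minimal divergence is `0`. -/
noncomputable def criticalT {k : ℕ} (ρ : Fin k → ℝ) (P : Matrix (Fin k) (Fin k) ℝ) : ENNReal :=
  (⨅ (i : Fin k) (j : Fin k) (_ : i ≠ j),
    ENNReal.ofReal (chDivergence (theta ρ P i) (theta ρ P j)))⁻¹

/-- Every community has size within `ε n` of `ρ_j n`, where `ε = n^{-1/3}`. -/
def BalancedLabels {k : ℕ} (ρ : Fin k → ℝ) {n : ℕ} (σ : Assignment n k) : Prop :=
  ∀ j, |((Finset.univ.filter fun v => σ v = j).card : ℝ) - n * ρ j|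
    ≤ (n : ℝ) ^ (-(1 / 3) : ℝ) * n

end CSBM

/-! ### Product laws and Chernoff coefficients of a single pair. -/

namespace CSBM

open Finset

/-! Fix balanced labels `σ₀`. The MAP estimator succeeds once every `σ` that is not a relabelling of
`σ₀` has smaller posterior weight than some other assignment. Markov's inequality
(`one_sub_sum_le_mapSuccessGiven`) reduces this to bounding exponential moments of three kinds of
bad event. By independence of the pairs, the `s`-th moment of the likelihood ratio of `σ` against
`σ₀` is at most `exp(-α * totalDefect)`, where `α` is the reveal probability.

Single flips: moving one vertex from label `i` to `j` has total defect about `n` times the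
Chernoff–Hellinger expression for `θ_j` and `θ_i`. As `t > t_c`, some exponent makes `t` times that
expression exceed 1, so all flips at once lose a factor `n ^ δ` with high probability.

Near assignments: up to an automorphism of `P`, the log-likelihood change of `σ` is the sum of its
single-flip changes, plus an error supported on revealed pairs inside the mismatch set. Small vertex
sets `D` span at most `ε |D| log n` revealed pairs, so the flips dominate the error, and also the
prior ratio, which is at most exponential in the distance (`pow_mul_graphProb_lt_of_near`).

Far assignments: `exists_automorphism_or_exists_cells` yields two linear-sized cells between which
the edge probabilities differ, so the defect is of order `n ^ 2`. The bound `exp(-c n log n)` beats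
the `k ^ n` assignments and the prior ratio.

The resulting bound is uniform over balanced labels, and random labels are balanced with high
probability. -/

/-- Expectation of a product of functions of independent coordinates. -/
theorem sum_prod_mul_prod {ι κ : Type*} [Fintype ι] [DecidableEq ι] [Fintype κ]
    (p f : ι → κ → ℝ) :
    ∑ x : ι → κ, (∏ i, p i (x i)) * ∏ i, f i (x i) = ∏ i, ∑ a, p i a * f i a := by
  rw [Finset.prod_univ_sum, Fintype.piFinset_univ]
  simp only [Finset.prod_mul_distrib]

theorem sum_prod_eq_one {ι κ : Type*} [Fintype ι] [DecidableEq ι] [Fintype κ]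
    (p : ι → κ → ℝ) (hp : ∀ i, ∑ a, p i a = 1) : ∑ x : ι → κ, ∏ i, p i (x i) = 1 := by
  have h := sum_prod_mul_prod p fun _ _ => 1
  simpa [hp] using h

/-- Summing over unordered pairs in both orders amounts to summing over ordered pairs. -/
theorem sum_vertexPair {n : ℕ} (f : Fin n → Fin n → ℝ) :
    ∑ e : VertexPair n, (f e.1.1 e.1.2 + f e.1.2 e.1.1)
      = ∑ u, ∑ v, if u ≠ v then f u v else 0 := by
  have h1 : ∀ g : Fin n → Fin n → ℝ, ∑ e : VertexPair n, g e.1.1 e.1.2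
      = ∑ u, ∑ v, if u < v then g u v else 0 := by
    intro g
    rw [← Fintype.sum_prod_type' (f := fun u v => if u < v then g u v else 0),
      ← Finset.sum_filter]
    exact (Finset.sum_subtype (Finset.univ.filter fun e : Fin n × Fin n => e.1 < e.2)
      (by simp) (fun e => g e.1 e.2)).symm
  rw [Finset.sum_add_distrib, h1 f, h1 fun u v => f v u,
    Finset.sum_comm (f := fun u v => if u < v then f v u else 0), ← Finset.sum_add_distrib]
  refine Finset.sum_congr rfl fun u _ => ?_
  rw [← Finset.sum_add_distrib]
  refine Finset.sum_congr rfl fun v _ => ?_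
  rcases lt_trichotomy u v with h | h | h
  · simp [h, h.ne, not_lt.2 h.le]
  · simp [h]
  · simp [h, h.ne', not_lt.2 h.le]

@[simp] theorem statusProb_present (p α : ℝ) : statusProb p α .present = p * α := by
  simp [statusProb, observe, bernoulliProb]

@[simp] theorem statusProb_absent (p α : ℝ) : statusProb p α .absent = (1 - p) * α := by
  simp [statusProb, observe, bernoulliProb]

@[simp] theorem statusProb_censored (p α : ℝ) : statusProb p α .censored = 1 - α := by
  simp [statusProb, observe, bernoulliProb]; ring

theorem sum_edgeStatus (f : EdgeStatus → ℝ) :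
    ∑ s, f s = f .present + f .absent + f .censored := by
  have : (Finset.univ : Finset EdgeStatus) = {.present, .absent, .censored} := rfl
  rw [this, Finset.sum_insert (by simp), Finset.sum_insert (by simp), Finset.sum_singleton]
  ring

theorem sum_statusProb (p α : ℝ) : ∑ s, statusProb p α s = 1 := by
  rw [sum_edgeStatus]; simp; ring

theorem statusProb_pos {p α : ℝ} (hp : p ∈ Set.Ioo (0 : ℝ) 1) (hα : α ∈ Set.Ioo (0 : ℝ) 1)
    (s : EdgeStatus) : 0 < statusProb p α s := by
  obtain ⟨h1, h2⟩ := hp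
  obtain ⟨h3, h4⟩ := hα
  cases s
  · simp; positivity
  · simp only [statusProb_absent]; exact mul_pos (by linarith) h3
  · simp; linarith

/-- One minus the Chernoff `s`-coefficient of two Bernoulli distributions. -/
noncomputable def bernoulliDefect (s p q : ℝ) : ℝ :=
  1 - p ^ s * q ^ (1 - s) - (1 - p) ^ s * (1 - q) ^ (1 - s)

/-- Weighted AM–GM applied to each of the two outcomes. -/
theorem bernoulliDefect_nonneg {s p q : ℝ} (hs : s ∈ Set.Icc (0 : ℝ) 1)
    (hp : p ∈ Set.Ioo (0 : ℝ) 1) (hq : q ∈ Set.Ioo (0 : ℝ) 1) : 0 ≤ bernoulliDefect s p q := by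
  have h1 := Real.geom_mean_le_arith_mean2_weighted hs.1 (sub_nonneg.2 hs.2) hp.1.le hq.1.le
    (by ring)
  have h2 := Real.geom_mean_le_arith_mean2_weighted hs.1 (sub_nonneg.2 hs.2)
    (sub_nonneg.2 hp.2.le) (sub_nonneg.2 hq.2.le) (by ring)
  unfold bernoulliDefect
  linarith

theorem bernoulliDefect_le_one {s p q : ℝ}
    (hp : p ∈ Set.Ioo (0 : ℝ) 1) (hq : q ∈ Set.Ioo (0 : ℝ) 1) : bernoulliDefect s p q ≤ 1 := by
  have h1 : 0 ≤ p ^ s * q ^ (1 - s) :=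
    mul_nonneg (Real.rpow_nonneg hp.1.le _) (Real.rpow_nonneg hq.1.le _)
  have h2 : 0 ≤ (1 - p) ^ s * (1 - q) ^ (1 - s) :=
    mul_nonneg (Real.rpow_nonneg (sub_nonneg.2 hp.2.le) _)
      (Real.rpow_nonneg (sub_nonneg.2 hq.2.le) _)
  unfold bernoulliDefect
  linarith

theorem bernoulliDefect_self {s p : ℝ} (hp : p ∈ Set.Ioo (0 : ℝ) 1) :
    bernoulliDefect s p p = 0 := by
  unfold bernoulliDefect
  rw [← Real.rpow_add hp.1, ← Real.rpow_add (sub_pos.2 hp.2)]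
  simp

/-- At `s = 1/2` the defect is half of `(√p - √q)² + (√(1-p) - √(1-q))²`, a squared Hellinger
distance. -/
theorem bernoulliDefect_half_pos {p q : ℝ} (hp : p ∈ Set.Ioo (0 : ℝ) 1)
    (hq : q ∈ Set.Ioo (0 : ℝ) 1) (hpq : p ≠ q) : 0 < bernoulliDefect (1 / 2) p q := by
  have h : bernoulliDefect (1 / 2) p q = 1 - √p * √q - √(1 - p) * √(1 - q) := by
    unfold bernoulliDefect
    norm_num [Real.sqrt_eq_rpow]
  have hne : √p - √q ≠ 0 := by
    intro h0
    exact hpq ((Real.sqrt_inj hp.1.le hq.1.le).1 (sub_eq_zero.1 h0))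
  have h1 := Real.sq_sqrt hp.1.le
  have h2 := Real.sq_sqrt hq.1.le
  have h3 := Real.sq_sqrt (sub_nonneg.2 hp.2.le)
  have h4 := Real.sq_sqrt (sub_nonneg.2 hq.2.le)
  have h5 : 0 < (√p - √q) ^ 2 := by positivity
  rw [h]
  nlinarith [sq_nonneg (√(1 - p) - √(1 - q))]

theorem mul_div_rpow {p q : ℝ} (s : ℝ) (hp : 0 < p) (hq : 0 < q) :
    q * (p / q) ^ s = p ^ s * q ^ (1 - s) := by
  rw [Real.div_rpow hp.le hq.le, Real.rpow_sub hq, Real.rpow_one]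
  ring

/-- Censoring has the same probability under both parameters, so its likelihood ratio is 1 and only
the revealed mass `α` contributes a defect. -/
theorem sum_statusProb_mul_rpow {p q α : ℝ} (s : ℝ) (hp : p ∈ Set.Ioo (0 : ℝ) 1)
    (hq : q ∈ Set.Ioo (0 : ℝ) 1) (hα : α ∈ Set.Ioo (0 : ℝ) 1) :
    ∑ a, statusProb q α a * (statusProb p α a / statusProb q α a) ^ s
      = 1 - α * bernoulliDefect s p q := by
  have hα' : α ≠ 0 := hα.1.ne'
  have hα'' : 1 - α ≠ 0 := (sub_pos.2 hα.2).ne'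
  rw [sum_edgeStatus]
  simp only [statusProb_present, statusProb_absent, statusProb_censored]
  rw [mul_div_mul_right _ _ hα', mul_div_mul_right _ _ hα', div_self hα'', Real.one_rpow,
    mul_right_comm, mul_div_rpow s hp.1 hq.1, mul_right_comm (1 - q),
    mul_div_rpow s (sub_pos.2 hp.2) (sub_pos.2 hq.2)]
  unfold bernoulliDefect
  ring

/-- Since `ρ_r ^ ξ * ρ_r ^ (1 - ξ) = ρ_r`, the weights factor out. This identifies the divergence in
the threshold with the Chernoff exponent of a single-vertex change. -/
theorem chAt_theta {k : ℕ} {ρ : Fin k → ℝ} (hρ : ∀ i, ρ i ∈ Set.Ioo (0 : ℝ) 1)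
    {P : Matrix (Fin k) (Fin k) ℝ} (hP : ∀ i j, P i j ∈ Set.Ioo (0 : ℝ) 1) (ξ : ℝ) (i j : Fin k) :
    chAt ξ (theta ρ P i) (theta ρ P j) = ∑ r, ρ r * bernoulliDefect ξ (P r i) (P r j) := by
  unfold chAt theta
  rw [Fintype.sum_sum_type, ← Finset.sum_add_distrib]
  refine Finset.sum_congr rfl fun r _ => ?_
  have key : ∀ x y : ℝ, 0 < x → 0 < y →
      (ρ r * x) ^ ξ * (ρ r * y) ^ (1 - ξ) = ρ r * (x ^ ξ * y ^ (1 - ξ)) := by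
    intro x y hx hy
    rw [Real.mul_rpow (hρ r).1.le hx.le, Real.mul_rpow (hρ r).1.le hy.le]
    have : ρ r ^ ξ * ρ r ^ (1 - ξ) = ρ r := by
      rw [← Real.rpow_add (hρ r).1]; simp
    linear_combination (x ^ ξ * y ^ (1 - ξ)) * this
  simp only [Sum.elim_inl, Sum.elim_inr]
  rw [key _ _ (hP r i).1 (hP r j).1,
    key _ _ (sub_pos.2 (hP r i).2) (sub_pos.2 (hP r j).2)]
  unfold bernoulliDefect
  ring

/-! ### Exponential moments of the censored graph. -/

section graph

variable {n k : ℕ} {P : Matrix (Fin k) (Fin k) ℝ} {t : ℝ}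

theorem sum_graphProb (σ : Assignment n k) : ∑ G, graphProb P t σ G = 1 :=
  sum_prod_eq_one _ fun _ => sum_statusProb _ _

theorem graphProb_pos (hP : ∀ i j, P i j ∈ Set.Ioo (0 : ℝ) 1)
    (hα : revealProb t n ∈ Set.Ioo (0 : ℝ) 1) (σ : Assignment n k) (G : CensoredGraph n) :
    0 < graphProb P t σ G :=
  Finset.prod_pos fun _ _ => statusProb_pos (hP _ _) hα _

/-- Chernoff bound: the expected power of the likelihood ratio under `σ₀`. -/
theorem sum_graphProb_mul_ratio_rpow_le (hP : ∀ i j, P i j ∈ Set.Ioo (0 : ℝ) 1)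
    (hα : revealProb t n ∈ Set.Ioo (0 : ℝ) 1) (σ₀ σ : Assignment n k) (s : ℝ)
    {K : ℝ} (hK : 0 < K) :
    ∑ G, graphProb P t σ₀ G * (K * (graphProb P t σ G / graphProb P t σ₀ G)) ^ s
      ≤ K ^ s * Real.exp (-(revealProb t n * ∑ e : VertexPair n,
        bernoulliDefect s (P (σ e.1.1) (σ e.1.2)) (P (σ₀ e.1.1) (σ₀ e.1.2)))) := by
  have h1 : ∀ G, graphProb P t σ₀ G * (K * (graphProb P t σ G / graphProb P t σ₀ G)) ^ s
      = K ^ s * (graphProb P t σ₀ G * ∏ e : VertexPair n,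
        (statusProb (P (σ e.1.1) (σ e.1.2)) (revealProb t n) (G e) /
          statusProb (P (σ₀ e.1.1) (σ₀ e.1.2)) (revealProb t n) (G e)) ^ s) := by
    intro G
    rw [Real.mul_rpow hK.le
      (div_nonneg (graphProb_pos hP hα _ _).le (graphProb_pos hP hα _ _).le),
      Real.finsetProd_rpow _ _ fun e _ =>
        div_nonneg (statusProb_pos (hP _ _) hα _).le (statusProb_pos (hP _ _) hα _).le,
      Finset.prod_div_distrib]
    unfold graphProb
    ring
  simp only [h1, ← Finset.mul_sum]
  refine mul_le_mul_of_nonneg_left ?_ (Real.rpow_nonneg hK.le _)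
  unfold graphProb
  rw [sum_prod_mul_prod (fun (e : VertexPair n) a =>
      statusProb (P (σ₀ e.1.1) (σ₀ e.1.2)) (revealProb t n) a) (fun e a =>
      (statusProb (P (σ e.1.1) (σ e.1.2)) (revealProb t n) a /
          statusProb (P (σ₀ e.1.1) (σ₀ e.1.2)) (revealProb t n) a) ^ s),
    Finset.mul_sum, ← Finset.sum_neg_distrib, Real.exp_sum]
  refine Finset.prod_le_prod (fun e _ => Finset.sum_nonneg fun a _ => ?_) fun e _ => ?_
  · exact mul_nonneg (statusProb_pos (hP _ _) hα _).le (Real.rpow_nonneg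
      (div_nonneg (statusProb_pos (hP _ _) hα _).le (statusProb_pos (hP _ _) hα _).le) _)
  · rw [sum_statusProb_mul_rpow s (hP _ _) (hP _ _) hα]
    exact Real.one_sub_le_exp_neg _

/-- The number of revealed pairs inside a set of vertices. -/
def revealedCount (D : Finset (Fin n)) (G : CensoredGraph n) : ℕ :=
  (univ.filter fun e : VertexPair n => (e.1.1 ∈ D ∧ e.1.2 ∈ D) ∧ G e ≠ .censored).card

theorem card_pairs_le (D : Finset (Fin n)) :
    (univ.filter fun e : VertexPair n => e.1.1 ∈ D ∧ e.1.2 ∈ D).card ≤ D.card ^ 2 := by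
  rw [sq, ← Finset.card_product]
  refine Finset.card_le_card_of_injOn (fun e => e.1) ?_ (Subtype.val_injective.injOn)
  intro e he
  simpa using he

/-- The count is a sum of independent Bernoulli variables of parameter `α`, each with moment
generating function `1 + α (e^l - 1) ≤ exp(α e^l)`. The crude bound `|D| ^ 2` on the number of pairs
suffices. -/
theorem sum_graphProb_mul_exp_revealedCount_le
    (hα : revealProb t n ∈ Set.Ioo (0 : ℝ) 1) (σ₀ : Assignment n k) (D : Finset (Fin n))
    {l : ℝ} :
    ∑ G, graphProb P t σ₀ G * Real.exp (l * revealedCount D G)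
      ≤ Real.exp (revealProb t n * Real.exp l * (D.card : ℝ) ^ 2) := by
  classical
  have h1 : ∀ G : CensoredGraph n, Real.exp (l * revealedCount D G)
      = ∏ e : VertexPair n, if (e.1.1 ∈ D ∧ e.1.2 ∈ D) ∧ G e ≠ .censored
          then Real.exp l else 1 := by
    intro G
    rw [Finset.prod_ite, Finset.prod_const, Finset.prod_const_one, mul_one, ← Real.exp_nat_mul,
      mul_comm]
    rfl
  simp only [h1]
  unfold graphProb
  rw [sum_prod_mul_prod (fun (e : VertexPair n) a =>
      statusProb (P (σ₀ e.1.1) (σ₀ e.1.2)) (revealProb t n) a) (fun e a =>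
      if (e.1.1 ∈ D ∧ e.1.2 ∈ D) ∧ a ≠ .censored then Real.exp l else 1)]
  have h2 : ∀ e : VertexPair n, ∑ a, statusProb (P (σ₀ e.1.1) (σ₀ e.1.2)) (revealProb t n) a *
      (if (e.1.1 ∈ D ∧ e.1.2 ∈ D) ∧ a ≠ .censored then Real.exp l else 1)
      = if e.1.1 ∈ D ∧ e.1.2 ∈ D then 1 + revealProb t n * (Real.exp l - 1) else 1 := by
    intro e
    rw [sum_edgeStatus]
    by_cases h : e.1.1 ∈ D ∧ e.1.2 ∈ D
    · simp [h]; ring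
    · simp [h]; ring
  simp only [h2]
  rw [Finset.prod_ite, Finset.prod_const, Finset.prod_const_one, mul_one]
  have h3 : 1 + revealProb t n * (Real.exp l - 1) ≤ Real.exp (revealProb t n * Real.exp l) := by
    have := Real.add_one_le_exp (revealProb t n * Real.exp l)
    nlinarith [hα.1]
  have h4 : 0 ≤ 1 + revealProb t n * (Real.exp l - 1) := by
    nlinarith [hα.1, hα.2, Real.exp_pos l, mul_pos hα.1 (Real.exp_pos l)]
  calc _ ≤ Real.exp (revealProb t n * Real.exp l) ^
        (univ.filter fun e : VertexPair n => e.1.1 ∈ D ∧ e.1.2 ∈ D).card :=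
        pow_le_pow_left₀ h4 h3 _
    _ ≤ Real.exp (revealProb t n * Real.exp l) ^ (D.card ^ 2) := by
        refine pow_le_pow_right₀ (Real.one_le_exp ?_) (card_pairs_le D)
        exact mul_nonneg hα.1.le (Real.exp_pos _).le
    _ = _ := by
        rw [← Real.exp_nat_mul]; push_cast; ring_nf

end graph

end CSBM

namespace CSBM

open Finset

/-! ### Deterministic comparison of posterior weights. -/

section comparison

variable {n k : ℕ} {P : Matrix (Fin k) (Fin k) ℝ} {t : ℝ}

/-- The vertices on which two assignments differ. -/
def mismatch (σ τ : Assignment n k) : Finset (Fin n) := univ.filter fun v => σ v ≠ τ v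

theorem mismatch_nonempty {σ τ : Assignment n k} (h : σ ≠ τ) : (mismatch σ τ).Nonempty := by
  obtain ⟨v, hv⟩ := Function.ne_iff.1 h
  exact ⟨v, by simpa [mismatch] using hv⟩

theorem mismatch_perm_comp (π : Equiv.Perm (Fin k)) (σ τ : Assignment n k) :
    mismatch (π ∘ σ) (π ∘ τ) = mismatch σ τ := by
  ext v; simp [mismatch]

theorem labelProb_pos {ρ : Fin k → ℝ} (hρ : ∀ i, ρ i ∈ Set.Ioo (0 : ℝ) 1) (σ : Assignment n k) :
    0 < labelProb ρ σ :=
  Finset.prod_pos fun _ _ => (hρ _).1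

theorem labelProb_le {ρ : Fin k → ℝ} (hρ : ∀ i, ρ i ∈ Set.Ioo (0 : ℝ) 1) {C : ℝ}
    (hC : ∀ i, 1 ≤ C * ρ i) (σ τ : Assignment n k) :
    labelProb ρ σ ≤ C ^ (mismatch σ τ).card * labelProb ρ τ := by
  have : C ^ (mismatch σ τ).card = ∏ v, if σ v ≠ τ v then C else 1 := by
    rw [Finset.prod_ite, Finset.prod_const, Finset.prod_const_one, mul_one]; rfl
  rw [this]
  unfold labelProb
  rw [← Finset.prod_mul_distrib]
  refine Finset.prod_le_prod (fun v _ => (hρ _).1.le) fun v _ => ?_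
  by_cases h : σ v = τ v
  · simp [h]
  · simpa [h] using (hρ (σ v)).2.le.trans (hC (τ v))

/-- A relabelling of the communities that preserves the edge probabilities. -/
def IsAutomorphism (P : Matrix (Fin k) (Fin k) ℝ) (π : Equiv.Perm (Fin k)) : Prop :=
  ∀ i j, P (π i) (π j) = P i j

theorem IsAutomorphism.graphProb_comp {π : Equiv.Perm (Fin k)} (hπ : IsAutomorphism P π)
    (σ : Assignment n k) (G : CensoredGraph n) :
    graphProb P t (π ∘ σ) G = graphProb P t σ G := by
  simp [graphProb, hπ _ _]

/-- The factor `α` cancels, and a censored pair carries no information. Hence only revealed pairs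
enter the error terms. -/
theorem abs_log_statusProb_sub_le {p₀ : ℝ} (hp₀ : 0 < p₀) {p q α : ℝ}
    (hp : p ∈ Set.Icc p₀ (1 - p₀)) (hq : q ∈ Set.Icc p₀ (1 - p₀))
    (hα : α ∈ Set.Ioo (0 : ℝ) 1) (a : EdgeStatus) :
    |Real.log (statusProb p α a) - Real.log (statusProb q α a)|
      ≤ if a ≠ .censored then -Real.log p₀ else 0 := by
  have key : ∀ x y : ℝ, x ∈ Set.Icc p₀ (1 - p₀) → y ∈ Set.Icc p₀ (1 - p₀) →
      |Real.log (x * α) - Real.log (y * α)| ≤ -Real.log p₀ := by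
    intro x y hx hy
    have hx0 : 0 < x := hp₀.trans_le hx.1
    have hy0 : 0 < y := hp₀.trans_le hy.1
    rw [Real.log_mul hx0.ne' hα.1.ne', Real.log_mul hy0.ne' hα.1.ne']
    have h1 := Real.log_le_log hp₀ hx.1
    have h2 := Real.log_le_log hp₀ hy.1
    have h3 := Real.log_nonpos hx0.le (by linarith [hx.2])
    have h4 := Real.log_nonpos hy0.le (by linarith [hy.2])
    rw [abs_le]
    constructor <;> linarith
  cases a
  · simpa using key p q hp hq
  · simpa using key (1 - p) (1 - q) ⟨by linarith [hp.2], by linarith [hp.1]⟩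
      ⟨by linarith [hq.2], by linarith [hq.1]⟩
  · simp

/-- The log-likelihood of an assignment against the log-likelihoods of its single-vertex changes. -/
theorem log_graphProb_sub_le {p₀ : ℝ} (hp₀ : 0 < p₀)
    (hP : ∀ i j, P i j ∈ Set.Icc p₀ (1 - p₀)) (hα : revealProb t n ∈ Set.Ioo (0 : ℝ) 1)
    (σ₀ σ : Assignment n k) (G : CensoredGraph n) :
    Real.log (graphProb P t σ G) - Real.log (graphProb P t σ₀ G)
      ≤ ∑ v, (Real.log (graphProb P t (Function.update σ₀ v (σ v)) G)
          - Real.log (graphProb P t σ₀ G))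
        + 3 * -Real.log p₀ * revealedCount (mismatch σ σ₀) G := by
  have hP' : ∀ i j, P i j ∈ Set.Ioo (0 : ℝ) 1 := fun i j =>
    ⟨hp₀.trans_le (hP i j).1, by linarith [(hP i j).2]⟩
  have hlog : ∀ τ : Assignment n k, Real.log (graphProb P t τ G) = ∑ e : VertexPair n,
      Real.log (statusProb (P (τ e.1.1) (τ e.1.2)) (revealProb t n) (G e)) := fun τ =>
    Real.log_prod fun e _ => (statusProb_pos (hP' _ _) hα _).ne'
  simp only [hlog, ← Finset.sum_sub_distrib]
  rw [Finset.sum_comm, revealedCount, Finset.card_filter]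
  push_cast
  rw [Finset.mul_sum, ← Finset.sum_add_distrib]
  refine Finset.sum_le_sum ?_
  rintro ⟨⟨u, w⟩, huw⟩ -
  have huw : u ≠ w := ne_of_lt huw
  dsimp only
  -- Only the flips at the two endpoints affect this pair. If just one endpoint is mismatched, the
  -- flip sum is exact.
  rw [Fintype.sum_eq_add u w huw (by
    rintro v ⟨hvu, hvw⟩
    rw [Function.update_of_ne hvu.symm, Function.update_of_ne hvw.symm, sub_self])]
  simp only [Function.update_self, Function.update_of_ne huw, Function.update_of_ne huw.symm]
  by_cases hu : σ u = σ₀ u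
  · simp [hu, mismatch]
  by_cases hw : σ w = σ₀ w
  · simp [hw, mismatch]
  -- Both endpoints are mismatched: the joint change and the two single changes each cost at most
  -- `-log p₀`, whence the factor 3.
  have h1 := abs_le.1 (abs_log_statusProb_sub_le hp₀ (hP (σ u) (σ w)) (hP (σ₀ u) (σ₀ w)) hα
    (G ⟨(u, w), by assumption⟩))
  have h2 := abs_le.1 (abs_log_statusProb_sub_le hp₀ (hP (σ u) (σ₀ w)) (hP (σ₀ u) (σ₀ w)) hα
    (G ⟨(u, w), by assumption⟩))
  have h3 := abs_le.1 (abs_log_statusProb_sub_le hp₀ (hP (σ₀ u) (σ w)) (hP (σ₀ u) (σ₀ w)) hα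
    (G ⟨(u, w), by assumption⟩))
  by_cases hG : G ⟨(u, w), by assumption⟩ = .censored
  · simp [hG]
  · simp only [hG, ne_eq, not_false_eq_true, if_true, mismatch, mem_filter, mem_univ, hu, hw,
      and_self] at h1 h2 h3 ⊢
    linarith [h1.2, h2.1, h3.1]

/-- If all single-vertex changes lose a factor `n ^ δ` and small sets span few revealed pairs, then
all assignments close to `σ₀` are less likely than `σ₀`, by a factor exponential in the distance. -/
theorem pow_mul_graphProb_lt_of_near {p₀ : ℝ} (hp₀ : 0 < p₀)
    (hP : ∀ i j, P i j ∈ Set.Icc p₀ (1 - p₀)) (hα : revealProb t n ∈ Set.Ioo (0 : ℝ) 1)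
    {σ₀ : Assignment n k} {G : CensoredGraph n} {δ ε η C : ℝ} (hC : 0 < C)
    (hε : 3 * -Real.log p₀ * ε ≤ δ / 2) (hn : Real.log C < δ / 2 * Real.log n)
    (hflip : ∀ v j, j ≠ σ₀ v → (n : ℝ) ^ δ *
      (graphProb P t (Function.update σ₀ v j) G / graphProb P t σ₀ G) < 1)
    (hcount : ∀ D : Finset (Fin n), D.Nonempty → (D.card : ℝ) ≤ η * n →
      (revealedCount D G : ℝ) ≤ ε * D.card * Real.log n)
    {σ : Assignment n k} (hσ : σ ≠ σ₀) (hd : ((mismatch σ σ₀).card : ℝ) ≤ η * n) :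
    C ^ (mismatch σ σ₀).card * graphProb P t σ G < graphProb P t σ₀ G := by
  have hP' : ∀ i j, P i j ∈ Set.Ioo (0 : ℝ) 1 := fun i j =>
    ⟨hp₀.trans_le (hP i j).1, by linarith [(hP i j).2]⟩
  have hpos : ∀ τ : Assignment n k, 0 < graphProb P t τ G := fun τ => graphProb_pos hP' hα τ G
  have hne := mismatch_nonempty hσ
  have hn0 : 0 < (n : ℝ) := by
    obtain ⟨v, -⟩ := hne
    exact_mod_cast v.pos
  have hlogn : 0 ≤ Real.log n := Real.log_natCast_nonneg n
  set d : ℝ := ((mismatch σ σ₀).card : ℝ) with hd_def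
  have hd0 : 0 < d := Nat.cast_pos.2 hne.card_pos
  have hM : 0 ≤ -Real.log p₀ := by
    have : Real.log p₀ ≤ 0 := Real.log_nonpos hp₀.le
      (by obtain ⟨v, -⟩ := hne; linarith [(hP (σ v) (σ v)).1, (hP (σ v) (σ v)).2])
    linarith
  have h1 := log_graphProb_sub_le hp₀ hP hα σ₀ σ G
  have h2 : ∑ v, (Real.log (graphProb P t (Function.update σ₀ v (σ v)) G)
      - Real.log (graphProb P t σ₀ G)) ≤ -(d * (δ * Real.log n)) := by
    have h3 : ∀ v, Real.log (graphProb P t (Function.update σ₀ v (σ v)) G)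
      - Real.log (graphProb P t σ₀ G) ≤ if σ v ≠ σ₀ v then -(δ * Real.log n) else 0 := by
      intro v
      by_cases hv : σ v = σ₀ v
      · simp [hv]
      · have h4 := Real.log_neg (mul_pos (Real.rpow_pos_of_pos hn0 δ)
          (div_pos (hpos _) (hpos _))) (hflip v _ hv)
        rw [Real.log_mul (Real.rpow_pos_of_pos hn0 δ).ne' (div_pos (hpos _) (hpos _)).ne',
          Real.log_rpow hn0, Real.log_div (hpos _).ne' (hpos _).ne'] at h4
        simp only [ne_eq, hv, not_false_eq_true, if_true]
        linarith
    refine (Finset.sum_le_sum fun v _ => h3 v).trans (le_of_eq ?_)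
    rw [← Finset.sum_filter, Finset.sum_const, nsmul_eq_mul]
    simp only [hd_def, mismatch]
    ring
  -- The interaction error uses up half of the gain `δ log n` per vertex; the other half absorbs
  -- `log C`.
  have h5 : 3 * -Real.log p₀ * revealedCount (mismatch σ σ₀) G ≤ δ / 2 * (d * Real.log n) :=
    calc _ ≤ 3 * -Real.log p₀ * (ε * d * Real.log n) :=
          mul_le_mul_of_nonneg_left (hcount _ hne hd) (by positivity)
      _ = (3 * -Real.log p₀ * ε) * (d * Real.log n) := by ring
      _ ≤ _ := mul_le_mul_of_nonneg_right hε (by positivity)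
  rw [← Real.log_lt_log_iff (mul_pos (pow_pos hC _) (hpos _)) (hpos _),
    Real.log_mul (pow_pos hC _).ne' (hpos _).ne', Real.log_pow, ← hd_def]
  have h6 := mul_lt_mul_of_pos_left hn hd0
  linarith

theorem labelProb_mul_graphProb_lt {ρ : Fin k → ℝ} (hρ : ∀ i, ρ i ∈ Set.Ioo (0 : ℝ) 1) {C : ℝ}
    (hC : ∀ i, 1 ≤ C * ρ i) (hP : ∀ i j, P i j ∈ Set.Ioo (0 : ℝ) 1)
    (hα : revealProb t n ∈ Set.Ioo (0 : ℝ) 1) {σ τ : Assignment n k} {G : CensoredGraph n}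
    (h : C ^ (mismatch σ τ).card * graphProb P t σ G < graphProb P t τ G) :
    labelProb ρ σ * graphProb P t σ G < labelProb ρ τ * graphProb P t τ G :=
  calc _ ≤ C ^ (mismatch σ τ).card * labelProb ρ τ * graphProb P t σ G :=
        mul_le_mul_of_nonneg_right (labelProb_le hρ hC σ τ) (graphProb_pos hP hα _ _).le
    _ = labelProb ρ τ * (C ^ (mismatch σ τ).card * graphProb P t σ G) := by ring
    _ < _ := mul_lt_mul_of_pos_left h (labelProb_pos hρ _)

theorem exactRecovery_perm_comp (π : Equiv.Perm (Fin k)) (σ₀ : Assignment n k) :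
    ExactRecovery (π ∘ σ₀) σ₀ := by
  -- Row `a` of a permutation matrix has its 1 in the column that is the image of `a`, so the
  -- inverse undoes `π`.
  refine ⟨π⁻¹, ?_⟩
  ext u i
  simp only [membership, Matrix.mul_apply, Matrix.of_apply, Function.comp_apply, ite_mul, one_mul,
    zero_mul, Finset.sum_ite_eq, Finset.mem_univ, if_true]
  simp [Equiv.Perm.permMatrix, PEquiv.toMatrix_apply, Equiv.toPEquiv_apply]

open Classical in
/-- If every assignment that is not a relabelling of `σ₀` is beaten by another one, the MAP
estimator recovers `σ₀`. -/
theorem sum_mapEstimator_eq_one {ρ : Fin k → ℝ} (hρ : ∀ i, ρ i ∈ Set.Ioo (0 : ℝ) 1)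
    (hP : ∀ i j, P i j ∈ Set.Ioo (0 : ℝ) 1)
    (hα : revealProb t n ∈ Set.Ioo (0 : ℝ) 1) {σ₀ : Assignment n k} {G : CensoredGraph n}
    (h : ∀ σ, (¬ ∃ π : Equiv.Perm (Fin k), σ = π ∘ σ₀) →
      ∃ τ, labelProb ρ σ * graphProb P t σ G < labelProb ρ τ * graphProb P t τ G) :
    ∑ σ' : Assignment n k, (if ExactRecovery σ' σ₀ then mapEstimator ρ P t G σ' else 0) = 1 := by
  have hZ : 0 < ∑ τ : Assignment n k, labelProb ρ τ * graphProb P t τ G :=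
    Finset.sum_pos (fun τ _ => mul_pos (labelProb_pos hρ _) (graphProb_pos hP hα _ _))
      ⟨σ₀, Finset.mem_univ _⟩
  have hmem : ∀ σ ∈ mapArgmax ρ P t G, ExactRecovery σ σ₀ := by
    intro σ hσ
    simp only [mapArgmax, Finset.mem_filter, Finset.mem_univ, true_and] at hσ
    by_contra hcon
    obtain ⟨τ, hτ⟩ := h σ (by
      rintro ⟨π, rfl⟩
      exact hcon (exactRecovery_perm_comp π σ₀))
    exact absurd (hσ τ) (not_le.2 (div_lt_div_of_pos_right hτ hZ))
  have hne : (mapArgmax ρ P t G).Nonempty := by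
    obtain ⟨σ, -, hσ⟩ := Finset.exists_max_image (Finset.univ : Finset (Assignment n k))
      (posterior ρ P t G) ⟨σ₀, Finset.mem_univ _⟩
    exact ⟨σ, by simpa [mapArgmax] using hσ⟩
  have h1 : ∀ σ, (if ExactRecovery σ σ₀ then mapEstimator ρ P t G σ else 0)
      = if σ ∈ mapArgmax ρ P t G then ((mapArgmax ρ P t G).card : ℝ)⁻¹ else 0 := by
    intro σ
    unfold mapEstimator
    by_cases hσ : σ ∈ mapArgmax ρ P t G
    · simp [hσ, hmem σ hσ]
    · simp [hσ]
  simp only [h1]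
  rw [← Finset.sum_filter, Finset.sum_const, nsmul_eq_mul, Finset.filter_mem_eq_inter,
    Finset.univ_inter]
  exact mul_inv_cancel₀ (by exact_mod_cast hne.card_pos.ne')

open Classical in
theorem sum_mapEstimator_mem_Icc (ρ : Fin k → ℝ) (P : Matrix (Fin k) (Fin k) ℝ) (t : ℝ)
    (σ₀ : Assignment n k) (G : CensoredGraph n) :
    ∑ σ' : Assignment n k, (if ExactRecovery σ' σ₀ then mapEstimator ρ P t G σ' else 0)
      ∈ Set.Icc (0 : ℝ) 1 := by
  have h0 : ∀ σ, 0 ≤ mapEstimator ρ P t G σ := by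
    intro σ; unfold mapEstimator; positivity
  constructor
  · exact Finset.sum_nonneg fun σ _ => by
      by_cases h : ExactRecovery σ σ₀ <;> simp [h, h0]
  · calc _ ≤ ∑ σ : Assignment n k, mapEstimator ρ P t G σ := Finset.sum_le_sum fun σ _ => by
          by_cases h : ExactRecovery σ σ₀ <;> simp [h, h0]
      _ ≤ 1 := by
        unfold mapEstimator
        rw [← Finset.sum_filter, Finset.sum_const, nsmul_eq_mul, Finset.filter_mem_eq_inter,
          Finset.univ_inter]
        exact mul_inv_le_one

end comparison

end CSBM

namespace CSBM

open Finset

/-! ### Lower bounds on the total defect. -/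

section defect

variable {n k : ℕ} {P : Matrix (Fin k) (Fin k) ℝ}

/-- The total defect between an assignment and the true labels. -/
noncomputable def totalDefect (P : Matrix (Fin k) (Fin k) ℝ) (s : ℝ) (σ σ₀ : Assignment n k) : ℝ :=
  ∑ e : VertexPair n, bernoulliDefect s (P (σ e.1.1) (σ e.1.2)) (P (σ₀ e.1.1) (σ₀ e.1.2))

/-- Only pairs containing `v` contribute. Replacing the `k` community sizes by `n ρ_r` costs at most
`n^{-1/3} n` each because defects lie in `[0, 1]`; the final 1 pays for the absent pair `(v, v)`. -/
theorem totalDefect_update_ge {ρ : Fin k → ℝ} (hP : ∀ i j, P i j ∈ Set.Ioo (0 : ℝ) 1)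
    (hPsymm : P.IsSymm) {σ₀ : Assignment n k} (hσ₀ : BalancedLabels ρ σ₀) {s : ℝ}
    (hs : s ∈ Set.Icc (0 : ℝ) 1) (v : Fin n) (j : Fin k) :
    n * ∑ r, ρ r * bernoulliDefect s (P r j) (P r (σ₀ v))
        - (k * ((n : ℝ) ^ (-(1 / 3) : ℝ) * n) + 1)
      ≤ totalDefect P s (Function.update σ₀ v j) σ₀ := by
  set D : Fin k → ℝ := fun r => bernoulliDefect s (P r j) (P r (σ₀ v)) with hD
  have hD0 : ∀ r, 0 ≤ D r := fun r => bernoulliDefect_nonneg hs (hP _ _) (hP _ _)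
  have hD1 : ∀ r, D r ≤ 1 := fun r => bernoulliDefect_le_one (hP _ _) (hP _ _)
  have h1 : ∑ w, D (σ₀ w) - D (σ₀ v) ≤ totalDefect P s (Function.update σ₀ v j) σ₀ := by
    have h2 := sum_vertexPair fun u w : Fin n => if u = v then D (σ₀ w) else 0
    have h3 : (∑ u, ∑ w, if u ≠ w then (if u = v then D (σ₀ w) else 0) else 0)
        = ∑ w, D (σ₀ w) - D (σ₀ v) := by
      rw [Finset.sum_eq_single v (by
        intro u _ hu
        simp [hu]) (by simp)]
      rw [eq_sub_iff_add_eq, ← Finset.sum_erase_add (univ : Finset (Fin n)) (fun w => D (σ₀ w))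
        (Finset.mem_univ v)]
      congr 1
      rw [← Finset.sum_erase_add (univ : Finset (Fin n)) _ (Finset.mem_univ v)]
      simp only [ne_eq, not_true_eq_false, if_false, add_zero, if_true]
      refine Finset.sum_congr rfl fun w hw => ?_
      rw [if_pos (Finset.ne_of_mem_erase hw).symm]
    rw [← h3, ← h2]
    refine Finset.sum_le_sum ?_
    rintro ⟨⟨u, w⟩, huw⟩ -
    have huw : u ≠ w := ne_of_lt huw
    dsimp only
    by_cases hu : u = v
    · subst hu
      simp only [if_true, huw.symm, if_false, Function.update_self, Function.update_of_ne huw.symm,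
        add_zero, hD]
      rw [hPsymm.apply (σ₀ w) j, hPsymm.apply (σ₀ w) (σ₀ u)]
    · by_cases hw : w = v
      · subst hw
        simp [hu, hD]
      · simp only [hu, hw, if_false, add_zero]
        exact bernoulliDefect_nonneg hs (hP _ _) (hP _ _)
  have h4 : ∑ w, D (σ₀ w) = ∑ r, ((univ.filter fun w => σ₀ w = r).card : ℝ) * D r := by
    simp only [Finset.card_filter, Nat.cast_sum, Finset.sum_mul]
    rw [Finset.sum_comm]
    simp
  have h5 : n * ∑ r, ρ r * D r - k * ((n : ℝ) ^ (-(1 / 3) : ℝ) * n) ≤ ∑ w, D (σ₀ w) := by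
    have h6 : (k : ℝ) * ((n : ℝ) ^ (-(1 / 3) : ℝ) * n)
        = ∑ _r : Fin k, (n : ℝ) ^ (-(1 / 3) : ℝ) * n := by simp
    rw [h4, h6, Finset.mul_sum, ← Finset.sum_sub_distrib]
    refine Finset.sum_le_sum fun r _ => ?_
    have h7 := (abs_le.1 (hσ₀ r)).1
    have h8 : 0 ≤ (n : ℝ) ^ (-(1 / 3) : ℝ) * n := by positivity
    nlinarith [hD0 r, hD1 r]
  have := hD1 (σ₀ v)
  linarith

/-- The vertices with a given pair of labels. -/
def cell (σ₀ σ : Assignment n k) (i j : Fin k) : Finset (Fin n) :=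
  univ.filter fun v => σ₀ v = i ∧ σ v = j

theorem sum_card_cell (σ₀ σ : Assignment n k) (i : Fin k) :
    ∑ j, ((cell σ₀ σ i j).card : ℝ) = (univ.filter fun v => σ₀ v = i).card := by
  norm_cast
  rw [Finset.card_eq_sum_card_fiberwise (f := σ) (t := univ) (by intro x _; simp)]
  simp [cell, Finset.filter_filter]

/-- Either `σ` is close to a relabelling of `σ₀` by an automorphism, or there are two large cells
between which the edge probabilities of `σ` and `σ₀` differ. -/
theorem exists_automorphism_or_exists_cells (hPsymm : P.IsSymm)
    (hcol : ∀ i j, i ≠ j → ∃ r, P r i ≠ P r j) {x : ℝ} (hx0 : 0 ≤ x)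
    {σ₀ : Assignment n k} (hx : ∀ i, k * x ≤ ((univ.filter fun v => σ₀ v = i).card : ℝ)) (σ : Assignment n k) :
    (∃ π, IsAutomorphism P π ∧ ((mismatch σ (π ∘ σ₀)).card : ℝ) ≤ k ^ 2 * x) ∨
      ∃ i j i' j', x ≤ (cell σ₀ σ i j).card ∧ x ≤ (cell σ₀ σ i' j').card ∧ P i i' ≠ P j j' := by
  rw [or_iff_not_imp_right]
  intro hbad
  push Not at hbad
  -- Pigeonhole: a community of size at least `k x` is split into `k` cells.
  have hbig : ∀ i, ∃ j, x ≤ (cell σ₀ σ i j).card := by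
    intro i
    obtain ⟨j, -, hj⟩ := Finset.exists_le_of_sum_le (s := (univ : Finset (Fin k)))
      (f := fun _ => x) (g := fun j => ((cell σ₀ σ i j).card : ℝ)) ⟨i, mem_univ _⟩
      (by rw [sum_card_cell]; simpa using hx i)
    exact ⟨j, hj⟩
  choose φ hφ using hbig
  have hcol' : ∀ i j, (∀ r, P i r = P j r) → i = j := by
    intro i j h
    by_contra hij
    obtain ⟨r, hr⟩ := hcol i j hij
    exact hr (by rw [← hPsymm.apply, h r, hPsymm.apply])
  -- Large cells preserve edge probabilities, so two labels with the same image would have equal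
  -- rows in `P`.
  have hinj : Function.Injective φ := by
    intro i j hij
    refine hcol' i j fun r => ?_
    rw [hbad i (φ i) r (φ r) (hφ i) (hφ r), hbad j (φ j) r (φ r) (hφ j) (hφ r), hij]
  have hbij := Finite.injective_iff_bijective.1 hinj
  refine ⟨Equiv.ofBijective φ hbij, fun i j => ?_, ?_⟩
  · exact (hbad i (φ i) j (φ j) (hφ i) (hφ j)).symm
  -- A second large cell in row `i` would make `j` and `φ i` have equal rows in `P`.
  have hsmall : ∀ i j, j ≠ φ i → ((cell σ₀ σ i j).card : ℝ) ≤ x := by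
    intro i j hij
    by_contra hlt
    refine hij (hcol' _ _ fun r => ?_)
    obtain ⟨i', rfl⟩ := hbij.2 r
    rw [← hbad i j i' (φ i') (not_le.1 hlt).le (hφ i'), hbad i (φ i) i' (φ i') (hφ i) (hφ i')]
  have hsub : mismatch σ (Equiv.ofBijective φ hbij ∘ σ₀)
      ⊆ (univ : Finset (Fin k × Fin k)).biUnion
        fun c => if c.2 ≠ φ c.1 then cell σ₀ σ c.1 c.2 else ∅ := by
    intro v hv
    have hv : σ v ≠ φ (σ₀ v) := (Finset.mem_filter.1 hv).2
    simp only [Finset.mem_biUnion, Finset.mem_univ, true_and]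
    exact ⟨(σ₀ v, σ v), by simp [hv, cell]⟩
  have hcard := (Finset.card_le_card hsub).trans Finset.card_biUnion_le
  have hcard' : ((mismatch σ (Equiv.ofBijective φ hbij ∘ σ₀)).card : ℝ)
      ≤ ∑ c : Fin k × Fin k, ((if c.2 ≠ φ c.1 then cell σ₀ σ c.1 c.2 else ∅).card : ℝ) := by
    exact_mod_cast hcard
  refine hcard'.trans ?_
  have hk : (k : ℝ) ^ 2 * x = ∑ _c : Fin k × Fin k, x := by simp [sq]
  rw [hk]
  refine Finset.sum_le_sum fun c _ => ?_
  by_cases hc : c.2 = φ c.1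
  · simpa [hc] using hx0
  · simpa [hc] using hsmall c.1 c.2 hc

/-- Every pair of distinct vertices joining the two cells has defect at least `h₀`. The cells may
coincide, so each ordered pair is charged only `h₀ / 2`; removing the diagonal leaves at least `x (x
- 1) ≥ x ^ 2 / 2` ordered pairs. -/
theorem totalDefect_half_ge (hP : ∀ i j, P i j ∈ Set.Ioo (0 : ℝ) 1) (hPsymm : P.IsSymm)
    {h₀ : ℝ} (hh₀ : 0 < h₀) (hdef : ∀ a b c d, P a b ≠ P c d →
      h₀ ≤ bernoulliDefect (1 / 2) (P a b) (P c d))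
    {σ₀ σ : Assignment n k} {x : ℝ} (hx : 2 ≤ x) {i j i' j' : Fin k}
    (h1 : x ≤ (cell σ₀ σ i j).card) (h2 : x ≤ (cell σ₀ σ i' j').card) (hne : P i i' ≠ P j j') :
    h₀ / 4 * x ^ 2 ≤ totalDefect P (1 / 2) σ σ₀ := by
  set A := cell σ₀ σ i j with hA
  set B := cell σ₀ σ i' j' with hB
  have h3 := sum_vertexPair fun u w : Fin n => if u ∈ A ∧ w ∈ B then h₀ / 2 else 0
  have h4 : ∑ e : VertexPair n, ((if e.1.1 ∈ A ∧ e.1.2 ∈ B then h₀ / 2 else 0)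
      + if e.1.2 ∈ A ∧ e.1.1 ∈ B then h₀ / 2 else 0) ≤ totalDefect P (1 / 2) σ σ₀ := by
    refine Finset.sum_le_sum ?_
    rintro ⟨⟨u, w⟩, huw⟩ -
    dsimp only
    have h0 := bernoulliDefect_nonneg (s := 1 / 2) ⟨by norm_num, by norm_num⟩
      (hP (σ u) (σ w)) (hP (σ₀ u) (σ₀ w))
    by_cases hc : (u ∈ A ∧ w ∈ B) ∨ (w ∈ A ∧ u ∈ B)
    · have h5 : P (σ u) (σ w) ≠ P (σ₀ u) (σ₀ w) := by
        rcases hc with ⟨hu, hw⟩ | ⟨hw, hu⟩ <;>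
          simp only [hA, hB, cell, Finset.mem_filter, Finset.mem_univ, true_and] at hu hw
        · rw [hu.1, hu.2, hw.1, hw.2]; exact hne.symm
        · rw [hu.1, hu.2, hw.1, hw.2, hPsymm.apply j j', hPsymm.apply i i']; exact hne.symm
      have h6 := hdef _ _ _ _ h5
      split_ifs <;> linarith
    · push Not at hc
      rw [if_neg (fun h => hc.1 h.1 h.2), if_neg (fun h => hc.2 h.1 h.2)]
      simpa using h0
  rw [h3] at h4
  refine le_trans ?_ h4
  have h7 : ∀ u, (if u ∈ A then ((B.card : ℝ) - 1) * (h₀ / 2) else 0)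
      ≤ ∑ w, if u ≠ w then (if u ∈ A ∧ w ∈ B then h₀ / 2 else 0) else 0 := by
    intro u
    by_cases hu : u ∈ A
    · simp only [hu, if_true, true_and, ← ite_and]
      rw [← Finset.sum_filter, Finset.sum_const, nsmul_eq_mul]
      refine mul_le_mul_of_nonneg_right ?_ (by positivity)
      have h8 : B.erase u ⊆ univ.filter fun w => u ≠ w ∧ w ∈ B := by
        intro w hw
        simp only [Finset.mem_erase] at hw
        simp [hw.1.symm, hw.2]
      have h9 : (B.card : ℝ) ≤ (B.erase u).card + 1 := by
        have := Finset.pred_card_le_card_erase (s := B) (a := u)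
        exact_mod_cast (by omega : B.card ≤ (B.erase u).card + 1)
      have h10 : ((B.erase u).card : ℝ) ≤ (univ.filter fun w => u ≠ w ∧ w ∈ B).card := by
        exact_mod_cast Finset.card_le_card h8
      linarith
    · simp [hu]
  refine le_trans ?_ (Finset.sum_le_sum fun u _ => h7 u)
  rw [← Finset.sum_filter, Finset.sum_const, nsmul_eq_mul, Finset.filter_mem_eq_inter,
    Finset.univ_inter]
  have h11 : x * (x / 2) ≤ (A.card : ℝ) * ((B.card : ℝ) - 1) :=
    mul_le_mul h1 (by linarith) (by linarith) (by positivity)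
  nlinarith

end defect

end CSBM

namespace CSBM

open Finset

/-! ### Probability bounds for a fixed number of vertices. -/

section bounds

variable {n k : ℕ} {ρ : Fin k → ℝ} {P : Matrix (Fin k) (Fin k) ℝ} {t : ℝ}

theorem mapSuccessGiven_le_one (hP : ∀ i j, P i j ∈ Set.Ioo (0 : ℝ) 1)
    (hα : revealProb t n ∈ Set.Ioo (0 : ℝ) 1) (σ₀ : Assignment n k) :
    mapSuccessGiven ρ P t σ₀ ≤ 1 := by
  rw [← sum_graphProb (P := P) (t := t) σ₀]
  exact Finset.sum_le_sum fun G _ =>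
    mul_le_of_le_one_right (graphProb_pos hP hα _ _).le (sum_mapEstimator_mem_Icc ρ P t σ₀ G).2

theorem mapSuccessGiven_nonneg (hP : ∀ i j, P i j ∈ Set.Ioo (0 : ℝ) 1)
    (hα : revealProb t n ∈ Set.Ioo (0 : ℝ) 1) (σ₀ : Assignment n k) :
    0 ≤ mapSuccessGiven ρ P t σ₀ :=
  Finset.sum_nonneg fun G _ =>
    mul_nonneg (graphProb_pos hP hα _ _).le (sum_mapEstimator_mem_Icc ρ P t σ₀ G).1

/-- Markov's inequality for the failure of the MAP estimator. -/
theorem one_sub_sum_le_mapSuccessGiven (hρ : ∀ i, ρ i ∈ Set.Ioo (0 : ℝ) 1)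
    (hP : ∀ i j, P i j ∈ Set.Ioo (0 : ℝ) 1) (hα : revealProb t n ∈ Set.Ioo (0 : ℝ) 1)
    (σ₀ : Assignment n k) {g : CensoredGraph n → ℝ} (hg : ∀ G, 0 ≤ g G)
    (h : ∀ G, g G < 1 → ∀ σ, (¬ ∃ π : Equiv.Perm (Fin k), σ = π ∘ σ₀) →
      ∃ τ, labelProb ρ σ * graphProb P t σ G < labelProb ρ τ * graphProb P t τ G) :
    1 - ∑ G, graphProb P t σ₀ G * g G ≤ mapSuccessGiven ρ P t σ₀ := by
  classical
  rw [← sum_graphProb (P := P) (t := t) σ₀, ← Finset.sum_sub_distrib]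
  refine Finset.sum_le_sum fun G _ => ?_
  rw [← mul_one_sub]
  refine mul_le_mul_of_nonneg_left ?_ (graphProb_pos hP hα _ _).le
  by_cases hG : g G < 1
  · rw [sum_mapEstimator_eq_one hρ hP hα (h G hG)]
    linarith [hg G]
  · linarith [(sum_mapEstimator_mem_Icc ρ P t σ₀ G).1]

/-- Of the margin `3 δ`, one `δ` pays for the factor `n ^ δ` and one for the fluctuation of the
community sizes. The last remains for the union bound over vertices and labels. -/
theorem sum_graphProb_mul_flip_le (hρ : ∀ i, ρ i ∈ Set.Ioo (0 : ℝ) 1)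
    (hP : ∀ i j, P i j ∈ Set.Ioo (0 : ℝ) 1) (hPsymm : P.IsSymm)
    (hα : revealProb t n ∈ Set.Ioo (0 : ℝ) 1) (hαt : revealProb t n = t * Real.log n / n)
    (hn : 1 ≤ n) {σ₀ : Assignment n k} (hσ₀ : BalancedLabels ρ σ₀) {δ s : ℝ} (hδ : 0 < δ)
    (hs : s ∈ Set.Icc (0 : ℝ) 1) {v : Fin n} {j : Fin k}
    (hch : 1 + 3 * δ ≤ t * chAt s (theta ρ P j) (theta ρ P (σ₀ v)))
    (hlarge : t * (k * (n : ℝ) ^ (-(1 / 3) : ℝ) + (n : ℝ)⁻¹) ≤ δ) :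
    ∑ G, graphProb P t σ₀ G * ((n : ℝ) ^ δ *
        (graphProb P t (Function.update σ₀ v j) G / graphProb P t σ₀ G)) ^ s
      ≤ (n : ℝ) ^ (-(1 + δ)) := by
  have hn0 : (0 : ℝ) < n := by exact_mod_cast hn
  have hn1 : (1 : ℝ) ≤ n := by exact_mod_cast hn
  have hlog : 0 ≤ Real.log n := Real.log_natCast_nonneg n
  refine (sum_graphProb_mul_ratio_rpow_le hP hα σ₀ (Function.update σ₀ v j) s
    (Real.rpow_pos_of_pos hn0 δ)).trans ?_
  have h1 : ((n : ℝ) ^ δ) ^ s ≤ Real.exp (δ * Real.log n) := by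
    rw [mul_comm δ, ← Real.rpow_def_of_pos hn0, ← Real.rpow_mul hn0.le]
    exact Real.rpow_le_rpow_of_exponent_le hn1 (mul_le_of_le_one_right hδ.le hs.2)
  have h2 := mul_le_mul_of_nonneg_left (totalDefect_update_ge hP hPsymm hσ₀ hs v j) hα.1.le
  rw [← chAt_theta hρ hP] at h2
  rw [Real.rpow_def_of_pos hn0 (-(1 + δ))]
  refine (mul_le_mul h1 le_rfl (Real.exp_pos _).le (Real.exp_pos _).le).trans ?_
  rw [← Real.exp_add]
  refine Real.exp_le_exp.2 ?_
  have h3 : revealProb t n * (n * chAt s (theta ρ P j) (theta ρ P (σ₀ v))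
      - (k * ((n : ℝ) ^ (-(1 / 3) : ℝ) * n) + 1))
      = Real.log n * (t * chAt s (theta ρ P j) (theta ρ P (σ₀ v))
        - t * (k * (n : ℝ) ^ (-(1 / 3) : ℝ) + (n : ℝ)⁻¹)) := by
    rw [hαt]
    field_simp
  rw [h3] at h2
  have h4 : Real.log n * (1 + 2 * δ) ≤ Real.log n * (t * chAt s (theta ρ P j) (theta ρ P (σ₀ v))
        - t * (k * (n : ℝ) ^ (-(1 / 3) : ℝ) + (n : ℝ)⁻¹)) :=
    mul_le_mul_of_nonneg_left (by linarith) hlog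
  have h5 := h4.trans h2
  unfold totalDefect at h5
  linarith

/-- The choice `l ε = 3` gives `n ^ (-3|D|)` from the threshold; smallness of `D` limits the moment
generating function to `n ^ |D|`. The surplus makes the bound summable over all `D`. -/
theorem sum_graphProb_mul_count_le
    (hα : revealProb t n ∈ Set.Ioo (0 : ℝ) 1) (hαt : revealProb t n = t * Real.log n / n)
    (hn : 1 ≤ n) (ht : 0 < t) (σ₀ : Assignment n k) {ε η l : ℝ} (hl : l * ε = 3)
    (hη : t * η * Real.exp l ≤ 1) {D : Finset (Fin n)} (hD : (D.card : ℝ) ≤ η * n) :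
    ∑ G, graphProb P t σ₀ G * Real.exp (l * (revealedCount D G - ε * D.card * Real.log n))
      ≤ ((n : ℝ)⁻¹ ^ 2) ^ D.card := by
  have hn0 : (0 : ℝ) < n := by exact_mod_cast hn
  have hlog : 0 ≤ Real.log n := Real.log_natCast_nonneg n
  have h1 : ∀ G : CensoredGraph n, graphProb P t σ₀ G *
      Real.exp (l * (revealedCount D G - ε * D.card * Real.log n))
      = Real.exp (-(3 * D.card * Real.log n)) *
        (graphProb P t σ₀ G * Real.exp (l * revealedCount D G)) := by
    intro G
    have h2 : l * (revealedCount D G - ε * D.card * Real.log n)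
        = -(3 * D.card * Real.log n) + l * revealedCount D G := by
      rw [← hl]; ring
    rw [h2, Real.exp_add]
    ring
  simp only [h1, ← Finset.mul_sum]
  refine (mul_le_mul_of_nonneg_left (sum_graphProb_mul_exp_revealedCount_le hα σ₀ D)
    (Real.exp_pos _).le).trans ?_
  rw [← Real.exp_add]
  have h2 : ((n : ℝ)⁻¹ ^ 2) ^ D.card = Real.exp (-(2 * D.card * Real.log n)) := by
    rw [← pow_mul, ← Real.exp_log (inv_pos.2 hn0), ← Real.exp_nat_mul, Real.log_inv]
    push_cast
    ring_nf
  rw [h2]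
  refine Real.exp_le_exp.2 ?_
  have h3 : revealProb t n * Real.exp l * (D.card : ℝ) ^ 2 ≤ D.card * Real.log n :=
    calc _ = t * Real.log n / n * Real.exp l * D.card * D.card := by rw [hαt]; ring
      _ ≤ t * Real.log n / n * Real.exp l * D.card * (η * n) :=
        mul_le_mul_of_nonneg_left hD (by positivity)
      _ = (t * η * Real.exp l) * (D.card * Real.log n) := by field_simp
      _ ≤ _ := mul_le_of_le_one_left (by positivity) hη
  linarith

/-- By the binomial theorem the sum is `(1 + n⁻²) ^ n - 1`. -/
theorem sum_nonempty_pow_card_le (hn : 1 ≤ n) :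
    ∑ D : Finset (Fin n), (if D.Nonempty then ((n : ℝ)⁻¹ ^ 2) ^ D.card else 0)
      ≤ Real.exp (n : ℝ)⁻¹ - 1 := by
  have hn0 : (0 : ℝ) < n := by exact_mod_cast hn
  have h1 : ∑ D : Finset (Fin n), ((n : ℝ)⁻¹ ^ 2) ^ D.card = (1 + (n : ℝ)⁻¹ ^ 2) ^ n := by
    have := Fintype.sum_pow_mul_eq_add_pow (Fin n) ((n : ℝ)⁻¹ ^ 2) 1
    simpa [add_comm] using this
  have h2 : ∀ D : Finset (Fin n), (if D.Nonempty then ((n : ℝ)⁻¹ ^ 2) ^ D.card else 0)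
      = ((n : ℝ)⁻¹ ^ 2) ^ D.card - if D = ∅ then 1 else 0 := by
    intro D
    rcases D.eq_empty_or_nonempty with rfl | h
    · simp
    · simp [h, h.ne_empty]
  simp only [h2, Finset.sum_sub_distrib, h1]
  have h3 : (1 + (n : ℝ)⁻¹ ^ 2) ^ n ≤ Real.exp (n : ℝ)⁻¹ :=
    calc _ ≤ Real.exp ((n : ℝ)⁻¹ ^ 2) ^ n := by
          refine pow_le_pow_left₀ (by positivity) ?_ _
          rw [add_comm]
          exact Real.add_one_le_exp _
      _ = _ := by
        rw [← Real.exp_nat_mul]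
        congr 1
        field_simp
  simpa using h3

theorem sum_graphProb_mul_far_le (hP : ∀ i j, P i j ∈ Set.Ioo (0 : ℝ) 1)
    (hα : revealProb t n ∈ Set.Ioo (0 : ℝ) 1) (hαt : revealProb t n = t * Real.log n / n)
    (hn : 1 ≤ n) {C h₀ η₀ : ℝ} (hC : 1 ≤ C) {σ₀ σ : Assignment n k}
    (hdef : h₀ / 4 * (η₀ * n) ^ 2 ≤ totalDefect P (1 / 2) σ σ₀) :
    ∑ G, graphProb P t σ₀ G * (C ^ n *
        (graphProb P t σ G / graphProb P t σ₀ G)) ^ (1 / 2 : ℝ)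
      ≤ C ^ n * Real.exp (-(t * h₀ / 4 * η₀ ^ 2 * Real.log n * n)) := by
  have hn0 : (0 : ℝ) < n := by exact_mod_cast hn
  have hCn : 1 ≤ C ^ n := one_le_pow₀ hC
  refine (sum_graphProb_mul_ratio_rpow_le hP hα σ₀ σ (1 / 2) (by positivity)).trans ?_
  refine mul_le_mul ?_ (Real.exp_le_exp.2 (neg_le_neg ?_)) (Real.exp_pos _).le (by positivity)
  · calc (C ^ n) ^ (1 / 2 : ℝ) ≤ (C ^ n) ^ (1 : ℝ) :=
          Real.rpow_le_rpow_of_exponent_le hCn (by norm_num)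
      _ = _ := Real.rpow_one _
  · refine le_trans (le_of_eq ?_) (mul_le_mul_of_nonneg_left hdef hα.1.le)
    rw [hαt]
    field_simp

/-- The exponents and constants of the union bound, for a fixed number of vertices. -/
theorem one_sub_le_mapSuccessGiven (hρ : ∀ i, ρ i ∈ Set.Ioo (0 : ℝ) 1)
    (hPsymm : P.IsSymm) (ht : 0 < t)
    (hcol : ∀ i j, i ≠ j → ∃ r, P r i ≠ P r j)
    {p₀ δ ε l η₀ C h₀ : ℝ} {ξ : Fin k → Fin k → ℝ}
    (hp₀ : 0 < p₀) (hPp₀ : ∀ i j, P i j ∈ Set.Icc p₀ (1 - p₀)) (hδ : 0 < δ)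
    (hξ : ∀ i j, i ≠ j → ξ i j ∈ Set.Icc (0 : ℝ) 1)
    (hch : ∀ i j, i ≠ j → 1 + 3 * δ ≤ t * chAt (ξ i j) (theta ρ P i) (theta ρ P j))
    (hl0 : 0 ≤ l) (hl : l * ε = 3) (hε : 3 * -Real.log p₀ * ε ≤ δ / 2)
    (hη₀ : 0 < η₀) (hη₀ρ : ∀ i, 2 * (k * η₀) ≤ ρ i) (hη₀t : t * (k ^ 2 * η₀) * Real.exp l ≤ 1)
    (hC : 1 ≤ C) (hCρ : ∀ i, 1 ≤ C * ρ i)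
    (hh₀ : 0 < h₀) (hdef : ∀ a b c d, P a b ≠ P c d →
      h₀ ≤ bernoulliDefect (1 / 2) (P a b) (P c d))
    (hn : 1 ≤ n) (hα : revealProb t n ∈ Set.Ioo (0 : ℝ) 1)
    (hαt : revealProb t n = t * Real.log n / n)
    (hlarge : t * (k * (n : ℝ) ^ (-(1 / 3) : ℝ) + (n : ℝ)⁻¹) ≤ δ)
    (hlogC : Real.log C < δ / 2 * Real.log n)
    (hη₀n : 2 ≤ η₀ * n) (hbal : (n : ℝ) ^ (-(1 / 3) : ℝ) ≤ k * η₀)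
    (hfar : k * C * Real.exp 1 ≤ Real.exp (t * h₀ / 4 * η₀ ^ 2 * Real.log n))
    {σ₀ : Assignment n k} (hσ₀ : BalancedLabels ρ σ₀) :
    1 - (k * (n : ℝ) ^ (-δ) + (Real.exp (n : ℝ)⁻¹ - 1) + Real.exp (-n))
      ≤ mapSuccessGiven ρ P t σ₀ := by
  classical
  have hP : ∀ i j, P i j ∈ Set.Ioo (0 : ℝ) 1 := fun i j =>
    ⟨hp₀.trans_le (hPp₀ i j).1, by linarith [(hPp₀ i j).2]⟩
  have hn0 : (0 : ℝ) < n := by exact_mod_cast hn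
  have hC0 : 0 < C := by linarith
  have hpos : ∀ (τ : Assignment n k) (G), 0 < graphProb P t τ G := graphProb_pos hP hα
  -- The radius is `k ^ 2` cells of size `η₀ n`, matching the cell dichotomy.
  let near : Assignment n k → Prop := fun σ => ∃ π, IsAutomorphism P π ∧
    ((mismatch σ (π ∘ σ₀)).card : ℝ) ≤ k ^ 2 * (η₀ * n)
  -- Each family is a Chernoff majorant, at least 1 on its bad event: a flip that loses too little,
  -- a small set with too many revealed pairs, a far assignment that competes.
  let g₁ : Fin n → Fin k → CensoredGraph n → ℝ := fun v j G =>
    if j ≠ σ₀ v then ((n : ℝ) ^ δ *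
      (graphProb P t (Function.update σ₀ v j) G / graphProb P t σ₀ G)) ^ ξ j (σ₀ v) else 0
  let g₂ : Finset (Fin n) → CensoredGraph n → ℝ := fun D G =>
    if D.Nonempty ∧ (D.card : ℝ) ≤ k ^ 2 * η₀ * n then
      Real.exp (l * (revealedCount D G - ε * D.card * Real.log n)) else 0
  let g₃ : Assignment n k → CensoredGraph n → ℝ := fun σ G =>
    if ¬ near σ then (C ^ n *
        (graphProb P t σ G / graphProb P t σ₀ G)) ^ (1 / 2 : ℝ) else 0
  have hg₁ : ∀ v j G, 0 ≤ g₁ v j G := fun v j G => by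
    have := hpos (Function.update σ₀ v j) G
    have := hpos σ₀ G
    simp only [g₁]; positivity
  have hg₂ : ∀ D G, 0 ≤ g₂ D G := fun D G => by simp only [g₂]; positivity
  have hg₃ : ∀ σ G, 0 ≤ g₃ σ G := fun σ G => by
    have := hpos σ G
    have := hpos σ₀ G
    simp only [g₃]; positivity
  have hmain := one_sub_sum_le_mapSuccessGiven hρ hP hα σ₀
    (g := fun G => ∑ v, ∑ j, g₁ v j G + ∑ D, g₂ D G + ∑ σ, g₃ σ G)
    (fun G => add_nonneg (add_nonneg
      (Finset.sum_nonneg fun v _ => Finset.sum_nonneg fun j _ => hg₁ v j G)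
      (Finset.sum_nonneg fun D _ => hg₂ D G)) (Finset.sum_nonneg fun σ _ => hg₃ σ G)) ?_
  · refine le_trans ?_ hmain
    have hswap : ∑ G, graphProb P t σ₀ G * (∑ v, ∑ j, g₁ v j G + ∑ D, g₂ D G + ∑ σ, g₃ σ G)
        = (∑ v, ∑ j, ∑ G, graphProb P t σ₀ G * g₁ v j G)
          + (∑ D, ∑ G, graphProb P t σ₀ G * g₂ D G)
          + ∑ σ, ∑ G, graphProb P t σ₀ G * g₃ σ G := by
      simp only [mul_add, Finset.sum_add_distrib, Finset.mul_sum]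
      rw [Finset.sum_comm (f := fun G D => graphProb P t σ₀ G * g₂ D G),
        Finset.sum_comm (f := fun G σ => graphProb P t σ₀ G * g₃ σ G),
        Finset.sum_comm (f := fun G v => ∑ j, graphProb P t σ₀ G * g₁ v j G)]
      congr 2
      exact Finset.sum_congr rfl fun v _ => Finset.sum_comm
    rw [hswap]
    refine sub_le_sub_left (add_le_add (add_le_add ?_ ?_) ?_) _
    · have h1 : ∀ v j, ∑ G, graphProb P t σ₀ G * g₁ v j G ≤ (n : ℝ) ^ (-(1 + δ)) := by
        intro v j
        by_cases hj : j = σ₀ v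
        · simp only [g₁, hj, ne_eq, not_true_eq_false, if_false, mul_zero, Finset.sum_const_zero]
          positivity
        · simp only [g₁, hj, ne_eq, not_false_eq_true, if_true]
          exact sum_graphProb_mul_flip_le hρ hP hPsymm hα hαt hn hσ₀ hδ (hξ _ _ hj)
            (hch _ _ hj) hlarge
      calc _ ≤ ∑ _v : Fin n, ∑ _j : Fin k, (n : ℝ) ^ (-(1 + δ)) :=
            Finset.sum_le_sum fun v _ => Finset.sum_le_sum fun j _ => h1 v j
        _ = k * ((n : ℝ) ^ (1 : ℝ) * (n : ℝ) ^ (-(1 + δ))) := by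
            simp; ring
        _ = _ := by
            rw [← Real.rpow_add hn0]; ring_nf
    · refine le_trans (Finset.sum_le_sum fun D _ => ?_) (sum_nonempty_pow_card_le hn)
      by_cases hD : D.Nonempty ∧ (D.card : ℝ) ≤ k ^ 2 * η₀ * n
      · simp only [g₂, hD, and_self, if_true]
        exact sum_graphProb_mul_count_le hα hαt hn ht σ₀ hl hη₀t hD.2
      · simp only [g₂, hD, if_false, mul_zero, Finset.sum_const_zero]
        positivity
    · have hrow : ∀ i, k * (η₀ * n) ≤ ((univ.filter fun v => σ₀ v = i).card : ℝ) := by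
        intro i
        have h1 := (abs_le.1 (hσ₀ i)).1
        have h2 := mul_le_mul_of_nonneg_right hbal hn0.le
        have h3 := mul_le_mul_of_nonneg_right (hη₀ρ i) hn0.le
        linarith
      have h1 : ∀ σ, ∑ G, graphProb P t σ₀ G * g₃ σ G
          ≤ C ^ n * Real.exp (-(t * h₀ / 4 * η₀ ^ 2 * Real.log n * n)) := by
        intro σ
        by_cases hσ : near σ
        · simp only [g₃, hσ, not_true_eq_false, if_false, mul_zero, Finset.sum_const_zero]
          positivity
        · simp only [g₃, hσ, not_false_eq_true, if_true]
          obtain ⟨i, j, i', j', hA, hB, hne⟩ := (exists_automorphism_or_exists_cells hPsymm hcol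
            (by positivity) hrow σ).resolve_left hσ
          exact sum_graphProb_mul_far_le hP hα hαt hn hC
            (totalDefect_half_ge hP hPsymm hh₀ hdef hη₀n hA hB hne)
      calc _ ≤ ∑ _σ : Assignment n k,
            C ^ n * Real.exp (-(t * h₀ / 4 * η₀ ^ 2 * Real.log n * n)) :=
            Finset.sum_le_sum fun σ _ => h1 σ
        _ = (k * C / Real.exp (t * h₀ / 4 * η₀ ^ 2 * Real.log n)) ^ n := by
            rw [Finset.sum_const, Finset.card_univ, Fintype.card_fun, Fintype.card_fin,
              Fintype.card_fin, nsmul_eq_mul, div_pow, mul_pow, ← Real.exp_nat_mul, Real.exp_neg]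
            push_cast
            rw [mul_comm (n : ℝ) (_ * _ : ℝ)]
            ring
        _ ≤ (Real.exp (-1)) ^ n := by
            refine pow_le_pow_left₀ (by positivity) ?_ _
            rw [div_le_iff₀ (Real.exp_pos _), Real.exp_neg, inv_mul_eq_div,
              le_div_iff₀ (Real.exp_pos _)]
            exact hfar
        _ = _ := by
            rw [← Real.exp_nat_mul]; ring_nf
  · intro G hG σ hσ
    have hs₁ : 0 ≤ ∑ v, ∑ j, g₁ v j G :=
      Finset.sum_nonneg fun v _ => Finset.sum_nonneg fun j _ => hg₁ v j G
    have hs₂ : 0 ≤ ∑ D, g₂ D G := Finset.sum_nonneg fun D _ => hg₂ D G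
    have hs₃ : 0 ≤ ∑ σ, g₃ σ G := Finset.sum_nonneg fun σ _ => hg₃ σ G
    have hG₁ : ∀ v j, g₁ v j G < 1 := fun v j => by
      have h1 := Finset.single_le_sum (f := fun j => g₁ v j G) (fun j _ => hg₁ v j G) (mem_univ j)
      have h2 := Finset.single_le_sum (f := fun v => ∑ j, g₁ v j G)
        (fun v _ => Finset.sum_nonneg fun j _ => hg₁ v j G) (mem_univ v)
      linarith
    have hG₂ : ∀ D, g₂ D G < 1 := fun D => by
      have h1 := Finset.single_le_sum (f := fun D => g₂ D G) (fun D _ => hg₂ D G) (mem_univ D)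
      linarith
    have hG₃ : ∀ σ, g₃ σ G < 1 := fun σ => by
      have h1 := Finset.single_le_sum (f := fun σ => g₃ σ G) (fun σ _ => hg₃ σ G) (mem_univ σ)
      linarith
    by_cases hnear : near σ
    · obtain ⟨π, hπ, hd⟩ := hnear
      -- The competitor is `π ∘ σ₀`, not `σ₀`: an automorphism preserves the likelihood but perhaps
      -- not the prior. Only the likelihood comparison is then pulled back by `π`.
      refine ⟨π ∘ σ₀, labelProb_mul_graphProb_lt hρ hCρ hP hα ?_⟩
      have hσeq : σ = π ∘ (π.symm ∘ σ) := by
        funext v; simp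
      have hne : π.symm ∘ σ ≠ σ₀ := by
        intro h
        exact hσ ⟨π, by rw [← h, ← hσeq]⟩
      rw [hσeq, mismatch_perm_comp] at hd ⊢
      rw [hπ.graphProb_comp, hπ.graphProb_comp]
      refine pow_mul_graphProb_lt_of_near (η := k ^ 2 * η₀) hp₀ hPp₀ hα hC0 hε hlogC ?_ ?_ hne
        (by rwa [mul_assoc])
      · intro v j hj
        have h1 := hG₁ v j
        simp only [g₁, hj, ne_eq, not_false_eq_true, if_true] at h1
        by_contra hcon
        exact absurd (Real.one_le_rpow (not_lt.1 hcon) (hξ _ _ hj).1) (not_le.2 h1)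
      · intro D hD hDc
        have h1 := hG₂ D
        simp only [g₂, hD, hDc, and_self, if_true, Real.exp_lt_one_iff] at h1
        by_contra hcon
        have := mul_nonneg hl0 (sub_nonneg.2 (not_le.1 hcon).le)
        linarith
    · refine ⟨σ₀, labelProb_mul_graphProb_lt hρ hCρ hP hα ?_⟩
      have h1 := hG₃ σ
      simp only [g₃, hnear, not_false_eq_true, if_true] at h1
      have h2 : C ^ n * (graphProb P t σ G / graphProb P t σ₀ G) < 1 := by
        by_contra hcon
        exact absurd (Real.one_le_rpow (not_lt.1 hcon) (by norm_num)) (not_le.2 h1)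
      rw [← mul_div_assoc, div_lt_one (hpos _ _)] at h2
      refine lt_of_le_of_lt (mul_le_mul_of_nonneg_right ?_ (hpos σ G).le) h2
      refine pow_le_pow_right₀ hC ?_
      simpa using Finset.card_le_univ (mismatch σ σ₀)

end bounds

end CSBM

namespace CSBM

open Finset Filter Topology

/-! ### Concentration of the community sizes. -/

section concentration

variable {n k : ℕ} {ρ : Fin k → ℝ}

theorem sum_labelProb (hρsum : ∑ i, ρ i = 1) : ∑ σ : Assignment n k, labelProb ρ σ = 1 :=
  sum_prod_eq_one (fun _ => ρ) fun _ => hρsum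

/-- Per vertex, `exp x ≤ 1 + x + x ^ 2` for `|x| ≤ 1`, and centring kills the linear term. -/
theorem sum_labelProb_mul_exp_le (hρ : ∀ i, ρ i ∈ Set.Ioo (0 : ℝ) 1) (hρsum : ∑ i, ρ i = 1)
    (j : Fin k) {l : ℝ} (hl : |l| ≤ 1) :
    ∑ σ : Assignment n k, labelProb ρ σ *
        Real.exp (l * (((univ.filter fun v => σ v = j).card : ℝ) - n * ρ j))
      ≤ Real.exp (n * l ^ 2) := by
  have h1 : ∀ σ : Assignment n k,
      Real.exp (l * (((univ.filter fun v => σ v = j).card : ℝ) - n * ρ j))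
      = ∏ v, Real.exp (l * ((if σ v = j then 1 else 0) - ρ j)) := by
    intro σ
    rw [← Real.exp_sum, ← Finset.mul_sum, Finset.sum_sub_distrib, Finset.card_filter]
    simp
  simp only [h1]
  unfold labelProb
  rw [sum_prod_mul_prod (fun (_ : Fin n) a => ρ a) (fun _ a =>
    Real.exp (l * ((if a = j then 1 else 0) - ρ j))), Finset.prod_const, Finset.card_univ,
    Fintype.card_fin, Real.exp_nat_mul]
  refine pow_le_pow_left₀ (Finset.sum_nonneg fun a _ => mul_nonneg (hρ a).1.le
    (Real.exp_pos _).le) ?_ _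
  have h2 : ∀ a, ρ a * Real.exp (l * ((if a = j then 1 else 0) - ρ j))
      ≤ ρ a * (1 + l ^ 2) + l * (ρ a * (if a = j then 1 else 0) - ρ a * ρ j) := by
    intro a
    set y : ℝ := (if a = j then 1 else 0) - ρ j with hy
    have hy1 : |y| ≤ 1 := by
      rw [hy, abs_le]
      split_ifs <;> constructor <;> linarith [(hρ j).1, (hρ j).2]
    have hly : |l * y| ≤ 1 := by
      rw [abs_mul]; exact mul_le_one₀ hl (abs_nonneg _) hy1
    have h3 := (abs_le.1 (Real.abs_exp_sub_one_sub_id_le hly)).2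
    have h4 : (l * y) ^ 2 ≤ l ^ 2 := by
      rw [mul_pow]
      exact mul_le_of_le_one_right (sq_nonneg _) ((sq_le_one_iff_abs_le_one y).2 hy1)
    calc _ ≤ ρ a * (1 + l * y + l ^ 2) :=
          mul_le_mul_of_nonneg_left (by linarith) (hρ a).1.le
      _ = _ := by rw [hy]; ring
  refine (Finset.sum_le_sum fun a _ => h2 a).trans ?_
  rw [Finset.sum_add_distrib, ← Finset.sum_mul, ← Finset.mul_sum, Finset.sum_sub_distrib,
    ← Finset.sum_mul, hρsum]
  simp only [mul_ite, mul_one, mul_zero, Finset.sum_ite_eq', Finset.mem_univ, if_true, one_mul,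
    sub_self, add_zero]
  rw [add_comm]
  exact Real.add_one_le_exp _

/-- Markov's inequality over the labels, with exponential bounds on the unbalanced ones. -/
theorem one_sub_le_mapSuccess {P : Matrix (Fin k) (Fin k) ℝ} {t : ℝ}
    (hρ : ∀ i, ρ i ∈ Set.Ioo (0 : ℝ) 1) (hρsum : ∑ i, ρ i = 1)
    (hP : ∀ i j, P i j ∈ Set.Ioo (0 : ℝ) 1)
    (hα : revealProb t n ∈ Set.Ioo (0 : ℝ) 1) (hn : 1 ≤ n) {f : ℝ} (hf : 0 ≤ f)
    (h : ∀ σ₀ : Assignment n k, BalancedLabels ρ σ₀ → 1 - f ≤ mapSuccessGiven ρ P t σ₀) :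
    1 - (f + 2 * k * Real.exp (-((n : ℝ) ^ (1 / 3 : ℝ) / 4))) ≤ mapSuccess ρ P t n := by
  have hn0 : (0 : ℝ) < n := by exact_mod_cast hn
  set z : ℝ := (n : ℝ) ^ (-(1 / 3) : ℝ) with hz
  have hz0 : 0 < z := Real.rpow_pos_of_pos hn0 _
  have hz1 : z ≤ 1 := Real.rpow_le_one_of_one_le_of_nonpos (by exact_mod_cast hn) (by norm_num)
  have hnz : (n : ℝ) * z ^ 2 = (n : ℝ) ^ (1 / 3 : ℝ) := by
    rw [hz, ← Real.rpow_natCast, ← Real.rpow_mul hn0.le]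
    nth_rw 1 [← Real.rpow_one (n : ℝ)]
    rw [← Real.rpow_add hn0]
    norm_num
  let X : Fin k → Assignment n k → ℝ := fun j σ =>
    ((univ.filter fun v => σ v = j).card : ℝ) - n * ρ j
  -- The tilts `l = ± z / 2` optimise `n l ^ 2 - |l| z n`, with value `-n z ^ 2 / 4 = -n ^ (1/3) /
  -- 4`; the two signs cover the two tails.
  let g : ℝ → Fin k → Assignment n k → ℝ := fun l j σ =>
    Real.exp (-(z / 2 * (z * n))) * Real.exp (l * X j σ)
  have hg : ∀ l j σ, 0 ≤ g l j σ := fun l j σ => by positivity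
  have hlow : ∀ σ, 1 - (f + ∑ j, (g (z / 2) j σ + g (-(z / 2)) j σ)) ≤ mapSuccessGiven ρ P t σ := by
    intro σ
    have hsum : 0 ≤ ∑ j, (g (z / 2) j σ + g (-(z / 2)) j σ) :=
      Finset.sum_nonneg fun j _ => add_nonneg (hg _ _ _) (hg _ _ _)
    by_cases hσ : BalancedLabels ρ σ
    · linarith [h σ hσ]
    · have h0 := mapSuccessGiven_nonneg (ρ := ρ) hP hα σ
      unfold BalancedLabels at hσ
      push Not at hσ
      obtain ⟨j, hj⟩ := hσ
      have h1 := Finset.single_le_sum (f := fun j => g (z / 2) j σ + g (-(z / 2)) j σ)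
        (fun j _ => add_nonneg (hg _ _ _) (hg _ _ _)) (mem_univ j)
      have h2 : 1 ≤ g (z / 2) j σ + g (-(z / 2)) j σ := by
        rcases lt_abs.1 hj with h3 | h3
        · have : 1 ≤ g (z / 2) j σ := by
            simp only [g, X, ← Real.exp_add]
            refine Real.one_le_exp ?_
            have := mul_le_mul_of_nonneg_left h3.le (by positivity : 0 ≤ z / 2)
            linarith
          linarith [hg (-(z / 2)) j σ]
        · have : 1 ≤ g (-(z / 2)) j σ := by
            simp only [g, X, ← Real.exp_add]
            refine Real.one_le_exp ?_
            have := mul_le_mul_of_nonneg_left h3.le (by positivity : 0 ≤ z / 2)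
            linarith
          linarith [hg (z / 2) j σ]
      linarith
  have hE : ∀ l j, |l| = z / 2 → ∑ σ, labelProb ρ σ * g l j σ
      ≤ Real.exp (-((n : ℝ) ^ (1 / 3 : ℝ) / 4)) := by
    intro l j hl
    have h1 : ∀ σ, labelProb ρ σ * g l j σ
        = Real.exp (-(z / 2 * (z * n))) * (labelProb ρ σ * Real.exp (l * X j σ)) := by
      intro σ; simp only [g]; ring
    simp only [h1, ← Finset.mul_sum]
    refine (mul_le_mul_of_nonneg_left (sum_labelProb_mul_exp_le hρ hρsum j
      (by linarith)) (Real.exp_pos _).le).trans ?_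
    rw [← Real.exp_add, ← hnz, ← sq_abs l, hl]
    refine Real.exp_le_exp.2 (le_of_eq ?_)
    ring
  calc 1 - (f + 2 * k * Real.exp (-((n : ℝ) ^ (1 / 3 : ℝ) / 4)))
      ≤ 1 - (f + ∑ j, (∑ σ, labelProb ρ σ * g (z / 2) j σ
          + ∑ σ, labelProb ρ σ * g (-(z / 2)) j σ)) := by
        refine sub_le_sub_left (add_le_add_right ?_ _) _
        refine (Finset.sum_le_sum fun j _ => add_le_add (hE (z / 2) j (abs_of_pos (by positivity)))
          (hE (-(z / 2)) j (by rw [abs_neg, abs_of_pos (by positivity)]))).trans (le_of_eq ?_)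
        simp; ring
    _ = ∑ σ : Assignment n k,
          labelProb ρ σ * (1 - (f + ∑ j, (g (z / 2) j σ + g (-(z / 2)) j σ))) := by
        simp only [mul_sub, mul_add, Finset.sum_sub_distrib, Finset.sum_add_distrib,
          Finset.mul_sum, mul_one]
        rw [sum_labelProb hρsum, ← Finset.sum_mul, sum_labelProb hρsum, one_mul,
          Finset.sum_comm (f := fun σ j => labelProb ρ σ * g (z / 2) j σ),
          Finset.sum_comm (f := fun σ j => labelProb ρ σ * g (-(z / 2)) j σ)]
    _ ≤ _ := Finset.sum_le_sum fun σ _ =>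
        mul_le_mul_of_nonneg_left (hlow σ) (labelProb_pos hρ σ).le

theorem mapSuccess_le_one {P : Matrix (Fin k) (Fin k) ℝ} {t : ℝ}
    (hρ : ∀ i, ρ i ∈ Set.Ioo (0 : ℝ) 1) (hρsum : ∑ i, ρ i = 1)
    (hP : ∀ i j, P i j ∈ Set.Ioo (0 : ℝ) 1) (hα : revealProb t n ∈ Set.Ioo (0 : ℝ) 1) :
    mapSuccess ρ P t n ≤ 1 := by
  rw [← sum_labelProb (n := n) hρsum]
  exact Finset.sum_le_sum fun σ _ =>
    mul_le_of_le_one_right (labelProb_pos hρ σ).le (mapSuccessGiven_le_one hP hα σ)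

end concentration

/-! ### Choice of constants and passage to the limit. -/

section asymptotics

variable {k : ℕ} {ρ : Fin k → ℝ} {P : Matrix (Fin k) (Fin k) ℝ} {t : ℝ}

/-- A number strictly below a supremum is exceeded by some value, so attainment of the maximum plays
no role. -/
theorem exists_one_lt_mul_chAt (ht : 0 < t) (htc : criticalT ρ P < ENNReal.ofReal t)
    {i j : Fin k} (hij : i ≠ j) :
    ∃ ξ ∈ Set.Icc (0 : ℝ) 1, 1 < t * chAt ξ (theta ρ P i) (theta ρ P j) := by
  unfold criticalT at htc
  rw [ENNReal.inv_lt_iff_inv_lt, ← ENNReal.ofReal_inv_of_pos ht] at htc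
  have h1 := htc.trans_le (iInf_le_of_le i (iInf_le_of_le j (iInf_le _ hij)))
  rw [ENNReal.ofReal_lt_ofReal_iff_of_nonneg (inv_pos.2 ht).le] at h1
  obtain ⟨_, ⟨ξ, hξ, rfl⟩, h2⟩ := exists_lt_of_lt_csSup
    ((Set.nonempty_Icc.2 zero_le_one).image _) h1
  refine ⟨ξ, hξ, ?_⟩
  have := mul_lt_mul_of_pos_left h2 ht
  rwa [mul_inv_cancel₀ ht.ne'] at this

/-- Letting `c` tend to 0 from the right also handles an empty index type, which has no minimum. -/
theorem exists_pos_forall_le {ι : Type*} [Finite ι] {a : ι → ℝ} (ha : ∀ i, 0 < a i) :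
    ∃ c, 0 < c ∧ ∀ i, c ≤ a i := by
  have h : ∀ᶠ c in 𝓝[>] (0 : ℝ), ∀ i, c ≤ a i :=
    eventually_all.2 fun i => (eventually_le_nhds (ha i)).filter_mono nhdsWithin_le_nhds
  obtain ⟨c, hc, hc0⟩ := (h.and self_mem_nhdsWithin).exists
  exact ⟨c, hc0, hc⟩

theorem eventually_revealProb (ht : 0 < t) :
    ∀ᶠ n : ℕ in atTop, revealProb t n ∈ Set.Ioo (0 : ℝ) 1 ∧
      revealProb t n = t * Real.log n / n := by
  have h1 : Tendsto (fun n : ℕ => t * (Real.log n / n)) atTop (𝓝 (t * 0)) := by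
    refine Tendsto.const_mul _ ?_
    have := (Real.tendsto_pow_log_div_mul_add_atTop 1 0 1 one_ne_zero).comp
      tendsto_natCast_atTop_atTop
    simpa [Function.comp_def] using this
  rw [mul_zero] at h1
  filter_upwards [h1.eventually_lt_const one_pos, eventually_ge_atTop 2] with n hn hn2
  rw [← mul_div_assoc] at hn
  have h2 : revealProb t n = t * Real.log n / n := min_eq_right hn.le
  have hn2' : (1 : ℝ) < n := by exact_mod_cast hn2
  have h3 := Real.log_pos hn2'
  refine ⟨⟨?_, by rwa [h2]⟩, h2⟩
  rw [h2]
  positivity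

/-- Above the threshold, the MAP estimator succeeds with probability tending to one, uniformly over
balanced labels. -/
theorem exists_tendsto_zero_one_sub_le_mapSuccessGiven (hρ : ∀ i, ρ i ∈ Set.Ioo (0 : ℝ) 1)
    (hρsum : ∑ i, ρ i = 1) (hP : ∀ i j, P i j ∈ Set.Ioo (0 : ℝ) 1) (hPsymm : P.IsSymm)
    (ht : 0 < t) (htc : criticalT ρ P < ENNReal.ofReal t) :
    ∃ f : ℕ → ℝ, Tendsto f atTop (𝓝 0) ∧ (∀ᶠ n in atTop, 0 ≤ f n) ∧
      ∀ᶠ n in atTop, ∀ σ₀ : Assignment n k, BalancedLabels ρ σ₀ →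
        1 - f n ≤ mapSuccessGiven ρ P t σ₀ := by
  have hk : 0 < k := by
    rcases Nat.eq_zero_or_pos k with rfl | h
    · simp at hρsum
    · exact h
  have hk' : (0 : ℝ) < k := by exact_mod_cast hk
  have hξ : ∀ i j, ∃ ξ : ℝ, i ≠ j → ξ ∈ Set.Icc (0 : ℝ) 1 ∧
      1 < t * chAt ξ (theta ρ P i) (theta ρ P j) := by
    intro i j
    by_cases hij : i = j
    · exact ⟨0, fun h => absurd hij h⟩
    · obtain ⟨ξ, h1, h2⟩ := exists_one_lt_mul_chAt ht htc hij
      exact ⟨ξ, fun _ => ⟨h1, h2⟩⟩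
  choose ξ hξ using hξ
  -- Equal columns would make the divergence vanish, contradicting `t > t_c`.
  have hcol : ∀ i j, i ≠ j → ∃ r, P r i ≠ P r j := by
    intro i j hij
    by_contra! hcon
    have h1 := (hξ i j hij).2
    rw [chAt_theta hρ hP] at h1
    simp only [hcon, bernoulliDefect_self (hP _ _), mul_zero, Finset.sum_const_zero] at h1
    linarith
  obtain ⟨p₀, hp₀, hPp₀⟩ := exists_pos_forall_le
    (a := fun c : Fin k × Fin k => min (P c.1 c.2) (1 - P c.1 c.2))
    fun c => lt_min (hP _ _).1 (sub_pos.2 (hP _ _).2)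
  have hPp₀ : ∀ i j, P i j ∈ Set.Icc p₀ (1 - p₀) := fun i j => by
    have := le_min_iff.1 (hPp₀ (i, j))
    exact ⟨this.1, by linarith [this.2]⟩
  obtain ⟨δ, hδ, hch⟩ := exists_pos_forall_le
    (a := fun c : {c : Fin k × Fin k // c.1 ≠ c.2} =>
      (t * chAt (ξ c.1.1 c.1.2) (theta ρ P c.1.1) (theta ρ P c.1.2) - 1) / 3)
    fun c => div_pos (sub_pos.2 (hξ _ _ c.2).2) (by norm_num)
  have hch : ∀ i j, i ≠ j → 1 + 3 * δ ≤ t * chAt (ξ i j) (theta ρ P i) (theta ρ P j) :=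
    fun i j hij => by
      have := hch ⟨(i, j), hij⟩
      dsimp only at this
      linarith
  obtain ⟨h₀, hh₀, hdef⟩ := exists_pos_forall_le
    (a := fun c : {c : (Fin k × Fin k) × Fin k × Fin k // P c.1.1 c.1.2 ≠ P c.2.1 c.2.2} =>
      bernoulliDefect (1 / 2) (P c.1.1.1 c.1.1.2) (P c.1.2.1 c.1.2.2))
    fun c => bernoulliDefect_half_pos (hP _ _) (hP _ _) c.2
  have hdef : ∀ a b c d, P a b ≠ P c d → h₀ ≤ bernoulliDefect (1 / 2) (P a b) (P c d) :=
    fun a b c d h => hdef ⟨((a, b), (c, d)), h⟩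
  obtain ⟨r₀, hr₀, hρr⟩ := exists_pos_forall_le fun i => (hρ i).1
  set M : ℝ := |Real.log p₀| with hM
  set ε : ℝ := δ / (6 * (M + 1)) with hε
  have hM0 : 0 ≤ M := abs_nonneg _
  have hε0 : 0 < ε := by positivity
  have hε1 : 3 * -Real.log p₀ * ε ≤ δ / 2 :=
    calc 3 * -Real.log p₀ * ε ≤ 3 * (M + 1) * ε := by
          refine mul_le_mul_of_nonneg_right ?_ hε0.le
          linarith [neg_le_abs (Real.log p₀)]
      _ = δ / 2 := by rw [hε]; field_simp; norm_num
  -- The first bound makes every balanced community large enough for the pigeonhole over its `k`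
  -- cells; the second controls the revealed-pair count at radius `k ^ 2 η₀ n`.
  set η₀ : ℝ := min (r₀ / (2 * k)) (1 / (t * k ^ 2 * Real.exp (3 / ε))) with hη₀
  have hη₀0 : 0 < η₀ := lt_min (by positivity) (by positivity)
  have hη₀1 : ∀ i, 2 * (k * η₀) ≤ ρ i := fun i => by
    refine le_trans ?_ (hρr i)
    have := (le_div_iff₀ (by positivity)).1 (min_le_left _ _ : η₀ ≤ r₀ / (2 * k))
    linarith
  have hη₀2 : t * (k ^ 2 * η₀) * Real.exp (3 / ε) ≤ 1 := by
    have := (le_div_iff₀ (by positivity)).1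
      (min_le_right _ _ : η₀ ≤ 1 / (t * k ^ 2 * Real.exp (3 / ε)))
    linarith
  set C : ℝ := max 1 r₀⁻¹ with hC
  have hC1 : 1 ≤ C := le_max_left _ _
  have hCρ : ∀ i, 1 ≤ C * ρ i := fun i =>
    calc 1 = r₀⁻¹ * r₀ := (inv_mul_cancel₀ hr₀.ne').symm
      _ ≤ C * ρ i := mul_le_mul (le_max_right _ _) (hρr i) hr₀.le (by linarith)
  have hcast : Tendsto (fun n : ℕ => (n : ℝ)) atTop atTop := tendsto_natCast_atTop_atTop
  have hlogt : Tendsto (fun n : ℕ => Real.log n) atTop atTop := Real.tendsto_log_atTop.comp hcast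
  have hz : Tendsto (fun n : ℕ => (n : ℝ) ^ (-(1 / 3) : ℝ)) atTop (𝓝 0) :=
    (tendsto_rpow_neg_atTop (by norm_num)).comp hcast
  have hinv : Tendsto (fun n : ℕ => (n : ℝ)⁻¹) atTop (𝓝 0) := tendsto_inv_atTop_zero.comp hcast
  refine ⟨fun n => k * (n : ℝ) ^ (-δ) + (Real.exp (n : ℝ)⁻¹ - 1) + Real.exp (-n), ?_, ?_, ?_⟩
  · have h1 : Tendsto (fun n : ℕ => (n : ℝ) ^ (-δ)) atTop (𝓝 0) :=
      (tendsto_rpow_neg_atTop hδ).comp hcast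
    have h2 : Tendsto (fun n : ℕ => Real.exp (n : ℝ)⁻¹) atTop (𝓝 1) := by
      have := (Real.continuous_exp.tendsto 0).comp hinv
      simpa [Function.comp_def] using this
    have h3 : Tendsto (fun n : ℕ => Real.exp (-n)) atTop (𝓝 0) :=
      Real.tendsto_exp_neg_atTop_nhds_zero.comp hcast
    simpa using ((h1.const_mul (k : ℝ)).add (h2.sub_const 1)).add h3
  · refine Eventually.of_forall fun n => ?_
    have : 1 ≤ Real.exp (n : ℝ)⁻¹ := Real.one_le_exp (by positivity)
    have h1 : 0 ≤ (k : ℝ) * (n : ℝ) ^ (-δ) := by positivity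
    linarith [Real.exp_pos (-(n : ℝ))]
  · have hl1 : Tendsto (fun n : ℕ => t * (k * (n : ℝ) ^ (-(1 / 3) : ℝ) + (n : ℝ)⁻¹)) atTop
        (𝓝 0) := by
      simpa using ((hz.const_mul (k : ℝ)).add hinv).const_mul t
    have hl2 : Tendsto (fun n : ℕ => δ / 2 * Real.log n) atTop atTop :=
      hlogt.const_mul_atTop (by positivity)
    have hl3 : Tendsto (fun n : ℕ => η₀ * n) atTop atTop := hcast.const_mul_atTop hη₀0
    have hl4 : Tendsto (fun n : ℕ => Real.exp (t * h₀ / 4 * η₀ ^ 2 * Real.log n)) atTop atTop :=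
      Real.tendsto_exp_atTop.comp (hlogt.const_mul_atTop (by positivity))
    filter_upwards [eventually_revealProb ht, eventually_ge_atTop 1,
      hl1.eventually_le_const hδ, hl2.eventually_gt_atTop (Real.log C),
      hl3.eventually_ge_atTop 2, hz.eventually_le_const (mul_pos hk' hη₀0),
      hl4.eventually_ge_atTop (k * C * Real.exp 1)] with n h1 h2 h3 h4 h5 h6 h7 σ₀ hσ₀
    exact one_sub_le_mapSuccessGiven hρ hPsymm ht hcol hp₀ hPp₀ hδ (fun i j h => (hξ i j h).1) hch
      (by positivity) (div_mul_cancel₀ 3 hε0.ne') hε1 hη₀0 hη₀1 hη₀2 hC1 hCρ hh₀ hdef h2 h1.1 h1.2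
      h3 h4 h5 h6 h7 hσ₀

end asymptotics

end CSBM

theorem theorem3p1 (k : ℕ) (ρ : Fin k → ℝ) (hρ : ∀ i, ρ i ∈ Set.Ioo (0 : ℝ) 1)
    (hρsum : ∑ i, ρ i = 1) (P : Matrix (Fin k) (Fin k) ℝ)
    (hP : ∀ i j, P i j ∈ Set.Ioo (0 : ℝ) 1) (hPsymm : P.IsSymm)
    (t : ℝ) (ht : 0 < t) (htc : CSBM.criticalT ρ P < ENNReal.ofReal t) :
    Filter.Tendsto (fun n : ℕ => CSBM.mapSuccess ρ P t n) Filter.atTop (nhds 1) ∧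
    ∀ σ₀ : (n : ℕ) → CSBM.Assignment n k,
      (∀ᶠ n in Filter.atTop, CSBM.BalancedLabels ρ (σ₀ n)) →
      Filter.Tendsto (fun n : ℕ => CSBM.mapSuccessGiven ρ P t (σ₀ n)) Filter.atTop (nhds 1) := by
  obtain ⟨f, hf, hf0, hbound⟩ :=
    CSBM.exists_tendsto_zero_one_sub_le_mapSuccessGiven hρ hρsum hP hPsymm ht htc
  have hreveal := CSBM.eventually_revealProb ht
  constructor
  · have h1 : Filter.Tendsto (fun n : ℕ => Real.exp (-((n : ℝ) ^ (1 / 3 : ℝ) / 4)))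
        Filter.atTop (nhds 0) :=
      Real.tendsto_exp_neg_atTop_nhds_zero.comp (((tendsto_rpow_atTop (by norm_num)).comp
        tendsto_natCast_atTop_atTop).atTop_div_const (by norm_num))
    have h2 : Filter.Tendsto
        (fun n : ℕ => 1 - (f n + 2 * k * Real.exp (-((n : ℝ) ^ (1 / 3 : ℝ) / 4))))
        Filter.atTop (nhds 1) := by
      simpa using (hf.add (h1.const_mul (2 * k : ℝ))).const_sub 1
    refine tendsto_of_tendsto_of_tendsto_of_le_of_le' h2 tendsto_const_nhds ?_ ?_
    · filter_upwards [hreveal, hf0, hbound, Filter.eventually_ge_atTop 1] with n hα hfn hn hn1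
      exact CSBM.one_sub_le_mapSuccess hρ hρsum hP hα.1 hn1 hfn hn
    · filter_upwards [hreveal] with n hα
      exact CSBM.mapSuccess_le_one hρ hρsum hP hα.1
  · intro σ₀ hσ₀
    refine tendsto_of_tendsto_of_tendsto_of_le_of_le' (by simpa using hf.const_sub 1)
      tendsto_const_nhds ?_ ?_
    · filter_upwards [hbound, hσ₀] with n hn hn'
      exact hn _ hn'
    · filter_upwards [hreveal] with n hα
      exact CSBM.mapSuccessGiven_le_one hP hα.1 _
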